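/- A plane partition in the box $[0,a]^3$ is a set $\pi$ of unit cubes $[x,x+1]\times[y,y+1]\times[z,z+1]$ with $x,y,z\in\{0,\dots,a-1\}$ (recorded as triples $(x,y,z)$) that is an order ideal for the componentwise order; it is cyclically symmetric if $\rho(\pi)=\pi$, where $\rho(\pi)=\{(x,y,z) : (y,z,x)\in\pi\}$. Let $N_3(a,a,a)$ be the number of cyclically symmetric plane partitions in $[0,a]^3$. Put $H_k(n)=(n-k)!\,(n-2k)!\,(n-3k)!\cdots$ (over all $j\ge 1$ with $n-jk\ge 0$), $H(n)=H_1(n)$, and $F_k(n)=n(n-k)(n-2k)\cdots$ (over all $j\ge 0$ with $n-jk>0$), empty products being $1$. Let $T(a)$ be the tiling of the regular hexagon $\{x+y+z=0,\ |x|,|y|,|z|\le a\}$ of side $a$ by unit equilateral triangles, cut out by the lines on which a coordinate is an integer. Denote a triangle by the integer parts $(i,j,k)$ of the coordinates of its interior points; it is called $\nabla$ if $i+j+k=-1$ and $\Delta$ if $i+j+k=-2$. Let $Z(a)$ be the graph whose vertices are the triangles of $T(a)$ and whose edges join triangles with a common side. The rotation $\rho(i,j,k)=(k,i,j)$ of the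 hexagon by $2\pi/3$ acts on $Z(a)$; let $Z_3(a)$ be the quotient multigraph, whose vertices and edges are the $\rho$-orbits of vertices and edges of $Z(a)$, and let $M_3(a)$ be its bipartite adjacency matrix: the rows are the $\nabla$ orbits, the columns are the $\Delta$ orbits, and the entries are the numbers of edges. Write $|\mathrm{Det}|$ for the absolute value of the determinant, which does not depend on how equinumerous index sets of rows and columns are identified. For $a\ge 1$ let $R_3(a)$ be $M_3(a)$ with one further row and one further column, both labelled $l$: for $0\le i<a$ the entry in row $l$ and in the column of the orbit of the $\Delta$ triangle $(a-1,\,-a+i,\,-1-i)$ is $(-1)^i$; the entry in column $l$ and in the row of the orbit of the $\nabla$ triangle $(-a,\,a-1-i,\,i)$ is $(-1)^i$; the $(l,l)$ entry is $2(-1)^a$; the other new entries are $0$. Theorem. (1) For every integer $a\ge 0$, $$N_3(a,a,a)=\frac{H_3(3a+2)\,H(a)}{H(2a)\,F_3(3a-2)}.$$ (2) For every $a\ge 0$, the matrix $M_3(a)$ has as many rows as columns, and $|\mathrm{Det}\,M_3(a)|=N_3(a,a,a)$. (3) For every $a\ge 1$ there is a unique family of rational coefficients $(\alpha_t)$, indexed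 by the $\nabla$ orbits, such that adding $\alpha_t$ times row $t$ to row $l$ of $R_3(a)$, for every $t$, gives a matrix $R_3'(a)$ in which all entries of row $l$ outside column $l$ vanish. The remaining entry is $$R_3'(a)_{l,l}=(-1)^a\,\frac{3a+2}{a}\,\binom{3a}{a-1}\bigg/\binom{2a}{a},$$ and $|\mathrm{Det}\,M_3(a+1)|=|R_3'(a)_{l,l}|\cdot|\mathrm{Det}\,M_3(a)|$. -/

import Mathlib

/-! ### Plane partitions and the counting function -/

/-- `π` is a plane partition: a finite order ideal of unit cubes in the positive octant.  The cube
`[x, x+1] × [y, y+1] × [z, z+1]` is recorded by its corner `(x, y, z)`. -/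
def IsPlanePartition (π : Finset (ℕ × ℕ × ℕ)) : Prop :=
  IsLowerSet (π : Set (ℕ × ℕ × ℕ))

/-- The set of unit cubes of the box `[0, a] × [0, b] × [0, c]`. -/
def box (a b c : ℕ) : Finset (ℕ × ℕ × ℕ) :=
  Finset.range a ×ˢ Finset.range b ×ˢ Finset.range c

/-- The rotation `ρ(π) = {(x, y, z) | (y, z, x) ∈ π}`. -/
def rotatePartition (π : Finset (ℕ × ℕ × ℕ)) : Finset (ℕ × ℕ × ℕ) :=
  π.image fun p => (p.2.2, p.1, p.2.1)

theorem mem_rotatePartition (π : Finset (ℕ × ℕ × ℕ)) (x y z : ℕ) :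
    (x, y, z) ∈ rotatePartition π ↔ (y, z, x) ∈ π := by
  simp only [rotatePartition, Finset.mem_image, Prod.exists, Prod.mk.injEq]
  constructor
  · rintro ⟨i, j, k, h, rfl, rfl, rfl⟩
    exact h
  · intro h
    exact ⟨y, z, x, h, rfl, rfl, rfl⟩

/-- The plane partitions in the `a × a × a` box that are cyclically symmetric. -/
def cyclicallySymmetricPlanePartitions (a : ℕ) : Set (Finset (ℕ × ℕ × ℕ)) :=
  {π | IsPlanePartition π ∧ π ⊆ box a a a ∧ rotatePartition π = π}

theorem finite_cyclicallySymmetricPlanePartitions (a : ℕ) :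
    (cyclicallySymmetricPlanePartitions a).Finite :=
  (Finset.finite_toSet (box a a a).powerset).subset fun _ hπ =>
    Finset.mem_coe.2 (Finset.mem_powerset.2 hπ.2.1)

/-- `N₃(a, a, a)`: the number of cyclically symmetric plane partitions in the `a × a × a` box. -/
noncomputable def N3 (a : ℕ) : ℕ :=
  (cyclicallySymmetricPlanePartitions a).ncard

/-- The staggered hyperfactorial `H_k(n) = (n-k)! (n-2k)! (n-3k)! ⋯`, over all `j ≥ 1` with
`n - jk ≥ 0`. -/
def stagHyperfactorial (k n : ℕ) : ℕ :=
  ∏ j ∈ Finset.Icc 1 (n / k), (n - j * k).factorial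

/-- The hyperfactorial `H(n) = H_1(n) = (n-1)! (n-2)! ⋯ 0!`. -/
def hyperfactorial (n : ℕ) : ℕ := stagHyperfactorial 1 n

/-- The staggered factorial `F_k(n) = n (n-k) (n-2k) ⋯`, over all `j ≥ 0` with `n - jk > 0`
(so it is an empty product for `n ≤ 0`). -/
def stagFactorial (k : ℕ) (n : ℤ) : ℤ :=
  ∏ j ∈ (Finset.range n.toNat).filter (fun j : ℕ => 0 < n - j * k), (n - j * k)

/-! ### The triangulated hexagon, its rotation and its quotient graph

In the plane `x + y + z = 0`, the lines on which a coordinate is an integer cut out a tiling by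
equilateral triangles.  A triangle is recorded by the integer parts `(i, j, k)` of the coordinates
of its interior points.  It has `i + j + k = -1` (the triangle `x ≥ i, y ≥ j, z ≥ k`) or
`i + j + k = -2` (the triangle `x ≤ i+1, y ≤ j+1, z ≤ k+1`); these are the two orientations, and
two triangles have a side in common iff their triples differ by `1` in exactly one place.  The
regular hexagon of side `a` is given by `-a ≤ x, y, z ≤ a`. -/

/-- The triangles of the tiling with `i + j + k = s` which lie in the regular hexagon of side
`a`. -/
def Triangle (s : ℤ) (a : ℕ) : Type :=
  {t : ℤ × ℤ × ℤ // (-(a : ℤ) ≤ t.1 ∧ t.1 < a) ∧ (-(a : ℤ) ≤ t.2.1 ∧ t.2.1 < a) ∧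
    (-(a : ℤ) ≤ t.2.2 ∧ t.2.2 < a) ∧ t.1 + t.2.1 + t.2.2 = s}

/-- The triangles `∇` of the hexagon of side `a`. -/
abbrev Nabla (a : ℕ) : Type := Triangle (-1) a

/-- The triangles `Δ` of the hexagon of side `a`. -/
abbrev Delta (a : ℕ) : Type := Triangle (-2) a

theorem finite_triangle (s : ℤ) (a : ℕ) : Finite (Triangle s a) := by
  refine Set.Finite.to_subtype (Set.Finite.subset
    (Finset.finite_toSet (Finset.Ico (-(a : ℤ)) a ×ˢ Finset.Ico (-(a : ℤ)) a ×ˢ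
      Finset.Ico (-(a : ℤ)) a)) ?_)
  rintro t ⟨h1, h2, h3, -⟩
  simp only [Finset.coe_product, Set.mem_prod, Finset.coe_Ico, Set.mem_Ico]
  exact ⟨h1, h2, h3⟩

/-- The rotation `ρ` by `2π/3` about the centre of the hexagon, on the triangles of a given
orientation. -/
def rho (s : ℤ) (a : ℕ) : Equiv.Perm (Triangle s a) where
  toFun t := ⟨(t.1.2.2, t.1.1, t.1.2.1), by
    obtain ⟨t, h1, h2, h3, h4⟩ := t
    exact ⟨h3, h1, h2, by simp only; omega⟩⟩
  invFun t := ⟨(t.1.2.1, t.1.2.2, t.1.1), by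
    obtain ⟨t, h1, h2, h3, h4⟩ := t
    exact ⟨h2, h3, h1, by simp only; omega⟩⟩
  left_inv _ := rfl
  right_inv _ := rfl

/-- A `∇` triangle and a `Δ` triangle with a common side. -/
def Adjacent {a : ℕ} (t : Nabla a) (u : Delta a) : Prop :=
  u.1 = (t.1.1 - 1, t.1.2.1, t.1.2.2) ∨ u.1 = (t.1.1, t.1.2.1 - 1, t.1.2.2) ∨
    u.1 = (t.1.1, t.1.2.1, t.1.2.2 - 1)

/-- The edges of the graph `Z(a, a, a)`, whose vertices are the triangles of the hexagon and whose
edges are the pairs of triangles with a common side (necessarily one `∇` and one `Δ`). -/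
def ZEdge (a : ℕ) : Type := {e : Nabla a × Delta a // Adjacent e.1 e.2}

/-- The action of the rotation `ρ` on the edges of `Z(a, a, a)`. -/
def rhoEdge (a : ℕ) : Equiv.Perm (ZEdge a) where
  toFun e := ⟨(rho (-1) a e.1.1, rho (-2) a e.1.2), by
    obtain ⟨⟨t, u⟩, h⟩ := e
    simp only [Adjacent, rho, Prod.ext_iff] at h ⊢
    tauto⟩
  invFun e := ⟨((rho (-1) a).symm e.1.1, (rho (-2) a).symm e.1.2), by
    obtain ⟨⟨t, u⟩, h⟩ := e
    simp only [Adjacent, rho, Prod.ext_iff] at h ⊢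
    tauto⟩
  left_inv _ := rfl
  right_inv _ := rfl

/-- The `ρ`-orbits of triangles of a given orientation.  For `s = -1` and `s = -2` these are the
two colour classes of vertices of the quotient graph `Z₃(a, a, a)`. -/
def TriangleOrbit (s : ℤ) (a : ℕ) : Type :=
  Quotient (Equiv.Perm.SameCycle.setoid (rho s a))

/-- The `ρ`-orbit of a triangle. -/
def orbitOf {s : ℤ} {a : ℕ} (t : Triangle s a) : TriangleOrbit s a :=
  Quotient.mk (Equiv.Perm.SameCycle.setoid (rho s a)) t

/-- The `∇` vertices of `Z₃(a, a, a)`. -/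
abbrev NablaOrbit (a : ℕ) : Type := TriangleOrbit (-1) a

/-- The `Δ` vertices of `Z₃(a, a, a)`. -/
abbrev DeltaOrbit (a : ℕ) : Type := TriangleOrbit (-2) a

/-- The edges of the quotient (multi)graph `Z₃(a, a, a)`: the `ρ`-orbits of edges of
`Z(a, a, a)`. -/
def Z3Edge (a : ℕ) : Type :=
  Quotient (Equiv.Perm.SameCycle.setoid (rhoEdge a))

/-- The edge of `Z₃(a, a, a)` given by an edge of `Z(a, a, a)`. -/
def edgeOrbitOf {a : ℕ} (e : ZEdge a) : Z3Edge a :=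
  Quotient.mk (Equiv.Perm.SameCycle.setoid (rhoEdge a)) e

/-- The edges of `Z₃(a, a, a)` which join the `∇` vertex `r` to the `Δ` vertex `c`. -/
def edgesBetween {a : ℕ} (r : NablaOrbit a) (c : DeltaOrbit a) : Set (Z3Edge a) :=
  {q | ∃ e : ZEdge a, edgeOrbitOf e = q ∧ orbitOf e.1.1 = r ∧ orbitOf e.1.2 = c}

theorem finite_zEdge (a : ℕ) : Finite (ZEdge a) := by
  have := finite_triangle (-1) a
  have := finite_triangle (-2) a
  exact Subtype.finite

theorem finite_edgesBetween {a : ℕ} (r : NablaOrbit a) (c : DeltaOrbit a) :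
    (edgesBetween r c).Finite := by
  have := finite_zEdge a
  have : Finite (Z3Edge a) := Quotient.finite _
  exact Set.toFinite _

noncomputable instance instFintypeTriangleOrbit (s : ℤ) (a : ℕ) : Fintype (TriangleOrbit s a) :=
  have := finite_triangle s a
  have : Finite (TriangleOrbit s a) := Quotient.finite _
  Fintype.ofFinite _

noncomputable instance instDecidableEqTriangleOrbit (s : ℤ) (a : ℕ) :
    DecidableEq (TriangleOrbit s a) :=
  Classical.decEq _

/-! ### The matrices -/

/-- The bipartite adjacency matrix `M₃(a, a, a)` of `Z₃(a, a, a)`: the rows are the `∇` orbits, the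
columns are the `Δ` orbits, and the entries are the numbers of edges. -/
noncomputable def M3 (a : ℕ) : Matrix (NablaOrbit a) (DeltaOrbit a) ℚ :=
  Matrix.of fun r c => ((edgesBetween r c).ncard : ℚ)

/-- The absolute determinant of a matrix with different index sets of the same size for the rows
and the columns (`0` if the sizes differ). -/
noncomputable def absDet {m n : Type} [Fintype m] [DecidableEq m] (A : Matrix m n ℚ) : ℚ :=
  open Classical in
  if h : Nonempty (m ≃ n) then |(A.submatrix id h.some).det| else 0

/-- The absolute determinant does not depend on how the two index sets are matched up. -/
theorem absDet_eq {m n : Type} [Fintype m] [DecidableEq m] (A : Matrix m n ℚ) (e : m ≃ n) :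
    absDet A = |(A.submatrix id e).det| := by
  have h : Nonempty (m ≃ n) := ⟨e⟩
  rw [absDet, dif_pos h]
  have key : A.submatrix id h.some =
      (A.submatrix id e).submatrix id (h.some.trans e.symm) := by
    ext i j
    simp
  rw [key, Matrix.det_permute', abs_mul]
  rcases Int.units_eq_one_or (Equiv.Perm.sign (h.some.trans e.symm)) with h1 | h1 <;>
    simp [h1]

/-- The triangles `z_i` of type `Δ` along a side `x = a` of the hexagon, `0 ≤ i < a`. -/
def zDelta {a : ℕ} (i : Fin a) : Delta a :=
  ⟨((a : ℤ) - 1, -(a : ℤ) + i, -1 - (i : ℤ)), by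
    have := i.2
    refine ⟨⟨?_, ?_⟩, ⟨?_, ?_⟩, ⟨?_, ?_⟩, ?_⟩ <;> simp only <;> omega⟩

/-- The triangles `z_i` of type `∇` along the opposite side `x = -a` of the hexagon,
`0 ≤ i < a`: the images of the `Δ` triangles `z_i` under the half turn of the hexagon. -/
def zNabla {a : ℕ} (i : Fin a) : Nabla a :=
  ⟨(-(a : ℤ), (a : ℤ) - 1 - i, (i : ℤ)), by
    have := i.2
    refine ⟨⟨?_, ?_⟩, ⟨?_, ?_⟩, ⟨?_, ?_⟩, ?_⟩ <;> simp only <;> omega⟩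

/-- The matrix `R₃(a, a, a)`: `M₃(a, a, a)` with one further row and one further column, both
labelled `l` (here `Sum.inr ()`), in which the `(l, z_i)` and `(z_i, l)` entries are `(-1)^i`, the
`(l, l)` entry is `2 (-1)^a`, and the other new entries are `0`. -/
noncomputable def R3 (a : ℕ) : Matrix (NablaOrbit a ⊕ Unit) (DeltaOrbit a ⊕ Unit) ℚ :=
  Matrix.fromBlocks (M3 a)
    (Matrix.of fun t _ => ∑ i : Fin a, if orbitOf (zNabla i) = t then (-1 : ℚ) ^ (i : ℕ) else 0)
    (Matrix.of fun _ u => ∑ i : Fin a, if orbitOf (zDelta i) = u then (-1 : ℚ) ^ (i : ℕ) else 0)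
    (Matrix.of fun _ _ => 2 * (-1 : ℚ) ^ a)

/-- The matrix obtained from `R₃(a, a, a)` by adding, for each `∇` orbit `t`, the `t` row
multiplied by `α t` to the `l` row. -/
noncomputable def R3' (a : ℕ) (α : NablaOrbit a → ℚ) :
    Matrix (NablaOrbit a ⊕ Unit) (DeltaOrbit a ⊕ Unit) ℚ :=
  Matrix.of fun t u => match t with
    | Sum.inl t => R3 a (Sum.inl t) u
    | Sum.inr _ => ∑ t : NablaOrbit a, α t * R3 a (Sum.inl t) u + R3 a (Sum.inr ()) u

/-! ### Orbits of the rotation -/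

/-! The determinant is evaluated by the representation theory of sl₂ and, independently, identified
with the number of partitions. Let V have basis vectors indexed by `-a ≤ i < a`, with a raising map
sending vector `i` to vector `i + 1` and a lowering map multiplying by `(a + i) * (a - i)` while
sending it to vector `i - 1`. The triangles with coordinate sum `s` index a weight space of the
triple tensor product, their orbits index its cyclic invariants, and `M3` is the raising operator
from sum -2 to sum -1 (`raiseMatrix_eq_M3`). By `lower_raise_apply`, lowering after raising differs
from raising after lowering by a scalar on each weight space. Together with the exchange of AB and
BA under the determinant, this carries the determinant of lowering after raising down to an empty
weight space, leaving a product of powers of squares (`weightDet_neg_two_eq_prod`). Lowering is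
adjoint to raising for a diagonal form (`lowerMatrix_apply`), so the same determinant is an explicit
factor times the square of the determinant of `M3`. Counting orbits yields the exponents, and
`abs_det_rhombusMatrix` puts the answer into closed form. For the count, every orbit of triangles
meets a fundamental rhombus of `a * a` lozenges once in each orientation, which makes `M3` a square
matrix. A cyclically symmetric plane partition is encoded by diagonal heights on this rhombus
(`N3_eq_ncard_isHeight`), these by perfect matchings of the quotient graph (`ncard_isMoveField`),
and matchings are the terms of the determinant. Every cycle of the resulting permutations has odd
length, so no cancellation occurs (`det_rhombusMatrix_eq_N3`). Passing from `a` to `a + 1` surrounds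
the rhombus by a ring. Eliminating all but one cell of the ring leaves a bordered matrix
(`det_rhombusMatrix_succ`), which is `R3` up to the sign of its last row. The nonzero determinant
makes the coefficients unique, and the remaining entry is the quotient of two consecutive counts,
read off from the product formula. -/

theorem sameCycle_iff_of_cube_eq_one {α : Type*} {f : Equiv.Perm α} (hf : ∀ x, f (f (f x)) = x)
    (x y : α) : f.SameCycle x y ↔ y = x ∨ y = f x ∨ y = f (f x) := by
  have h3 : f ^ (3 : ℤ) = 1 := by
    ext z
    rw [show (3 : ℤ) = ((3 : ℕ) : ℤ) from rfl, zpow_natCast]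
    simp [pow_succ, hf]
  constructor
  · rintro ⟨n, rfl⟩
    have hn : f ^ n = f ^ (n % 3) := by
      conv_lhs => rw [← Int.emod_add_mul_ediv n 3, zpow_add, zpow_mul, h3, one_zpow, mul_one]
    rw [hn]
    have h0 := Int.emod_nonneg n (show (3 : ℤ) ≠ 0 by norm_num)
    have h1 := Int.emod_lt_of_pos n (show (0 : ℤ) < 3 by norm_num)
    generalize n % 3 = r at h0 h1
    interval_cases r
    · simp
    · simp
    · right; right
      rw [show (2 : ℤ) = ((2 : ℕ) : ℤ) from rfl, zpow_natCast]
      simp [pow_succ]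
  · rintro (rfl | rfl | rfl)
    · exact Equiv.Perm.SameCycle.refl _ _
    · exact ⟨1, by simp⟩
    · exact ⟨2, by
        rw [show (2 : ℤ) = ((2 : ℕ) : ℤ) from rfl, zpow_natCast]
        simp [pow_succ]⟩

/-- The triple `t` records a triangle of the hexagon of side `a` with coordinate sum `s`. -/
def InHexagon (s : ℤ) (a : ℕ) (t : ℤ × ℤ × ℤ) : Prop :=
  (-(a : ℤ) ≤ t.1 ∧ t.1 < a) ∧ (-(a : ℤ) ≤ t.2.1 ∧ t.2.1 < a) ∧
    (-(a : ℤ) ≤ t.2.2 ∧ t.2.2 < a) ∧ t.1 + t.2.1 + t.2.2 = s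

/-- The triple recording a triangle. -/
def Triangle.coords {s : ℤ} {a : ℕ} (t : Triangle s a) : ℤ × ℤ × ℤ := t.1

/-- The triangle recorded by a triple. -/
def Triangle.ofCoords {s : ℤ} {a : ℕ} (t : ℤ × ℤ × ℤ) (h : InHexagon s a t) : Triangle s a :=
  ⟨t, h⟩

/-- The rotation on triples. -/
def rotateCoords (t : ℤ × ℤ × ℤ) : ℤ × ℤ × ℤ := (t.2.2, t.1, t.2.1)

theorem Triangle.coords_inHexagon {s : ℤ} {a : ℕ} (t : Triangle s a) : InHexagon s a t.coords :=
  t.2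

theorem Triangle.coords_injective {s : ℤ} {a : ℕ} :
    Function.Injective (Triangle.coords : Triangle s a → ℤ × ℤ × ℤ) :=
  Subtype.val_injective

theorem Triangle.coords_ofCoords {s : ℤ} {a : ℕ} (t : ℤ × ℤ × ℤ) (h : InHexagon s a t) :
    (Triangle.ofCoords t h).coords = t := rfl

theorem Triangle.ofCoords_coords {s : ℤ} {a : ℕ} (t : Triangle s a) :
    Triangle.ofCoords t.coords t.coords_inHexagon = t := rfl

theorem coords_rho {s : ℤ} {a : ℕ} (t : Triangle s a) :
    (rho s a t).coords = rotateCoords t.coords := rfl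

theorem adjacent_iff_left {a : ℕ} (t : Nabla a) (u : Delta a) :
    Adjacent t u ↔ u.coords = (t.coords.1 - 1, t.coords.2.1, t.coords.2.2) ∨
      u.coords = (t.coords.1, t.coords.2.1 - 1, t.coords.2.2) ∨
      u.coords = (t.coords.1, t.coords.2.1, t.coords.2.2 - 1) :=
  Iff.rfl

theorem adjacent_iff_right {a : ℕ} (t : Nabla a) (u : Delta a) :
    Adjacent t u ↔ t.coords = (u.coords.1 + 1, u.coords.2.1, u.coords.2.2) ∨
      t.coords = (u.coords.1, u.coords.2.1 + 1, u.coords.2.2) ∨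
      t.coords = (u.coords.1, u.coords.2.1, u.coords.2.2 + 1) := by
  rw [adjacent_iff_left]
  simp only [Prod.ext_iff]
  omega

/-- The edge given by two adjacent triangles. -/
def ZEdge.mk {a : ℕ} (t : Nabla a) (u : Delta a) (h : Adjacent t u) : ZEdge a := ⟨(t, u), h⟩

/-- The `∇` end of an edge. -/
def ZEdge.nabla {a : ℕ} (e : ZEdge a) : Nabla a := e.1.1

/-- The `Δ` end of an edge. -/
def ZEdge.delta {a : ℕ} (e : ZEdge a) : Delta a := e.1.2

theorem ZEdge.adjacent {a : ℕ} (e : ZEdge a) : Adjacent e.nabla e.delta := e.2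

theorem ZEdge.ext {a : ℕ} {e e' : ZEdge a} (h : e.nabla = e'.nabla) (h' : e.delta = e'.delta) :
    e = e' :=
  Subtype.ext (Prod.ext h h')

theorem mem_edgesBetween {a : ℕ} (r : NablaOrbit a) (c : DeltaOrbit a) (q : Z3Edge a) :
    q ∈ edgesBetween r c ↔
      ∃ e : ZEdge a, edgeOrbitOf e = q ∧ orbitOf e.nabla = r ∧ orbitOf e.delta = c :=
  Iff.rfl

theorem rho_rho_rho {s : ℤ} {a : ℕ} (t : Triangle s a) :
    rho s a (rho s a (rho s a t)) = t := rfl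

theorem rhoEdge_rhoEdge_rhoEdge {a : ℕ} (e : ZEdge a) :
    rhoEdge a (rhoEdge a (rhoEdge a e)) = e := rfl

theorem orbitOf_eq_iff {s : ℤ} {a : ℕ} (t u : Triangle s a) :
    orbitOf t = orbitOf u ↔ u = t ∨ u = rho s a t ∨ u = rho s a (rho s a t) := by
  rw [← sameCycle_iff_of_cube_eq_one rho_rho_rho]
  exact Quotient.eq (r := Equiv.Perm.SameCycle.setoid (rho s a))

theorem orbitOf_rho {s : ℤ} {a : ℕ} (t : Triangle s a) : orbitOf (rho s a t) = orbitOf t :=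
  ((orbitOf_eq_iff _ _).2 (Or.inr (Or.inl rfl))).symm

theorem edgeOrbitOf_eq_iff {a : ℕ} (e e' : ZEdge a) :
    edgeOrbitOf e = edgeOrbitOf e' ↔
      e' = e ∨ e' = rhoEdge a e ∨ e' = rhoEdge a (rhoEdge a e) := by
  rw [← sameCycle_iff_of_cube_eq_one rhoEdge_rhoEdge_rhoEdge]
  exact Quotient.eq (r := Equiv.Perm.SameCycle.setoid (rhoEdge a))

theorem exists_orbitOf_eq {s : ℤ} {a : ℕ} (r : TriangleOrbit s a) :
    ∃ t : Triangle s a, orbitOf t = r := by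
  obtain ⟨t, ht⟩ := Quotient.exists_rep r
  exact ⟨t, ht⟩

theorem rho_ne_self {s : ℤ} {a : ℕ} (hs : ¬ 3 ∣ s) (t : Triangle s a) : rho s a t ≠ t := by
  intro h
  obtain ⟨-, -, -, h4⟩ := t.coords_inHexagon
  have h := congrArg Triangle.coords h
  simp only [coords_rho, rotateCoords, Prod.ext_iff] at h
  omega

theorem rho_rho_ne_self {s : ℤ} {a : ℕ} (hs : ¬ 3 ∣ s) (t : Triangle s a) :
    rho s a (rho s a t) ≠ t := by
  intro h
  obtain ⟨-, -, -, h4⟩ := t.coords_inHexagon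
  have h := congrArg Triangle.coords h
  simp only [coords_rho, rotateCoords, Prod.ext_iff] at h
  omega

noncomputable instance instFintypeTriangle (s : ℤ) (a : ℕ) : Fintype (Triangle s a) :=
  have := finite_triangle s a
  Fintype.ofFinite _

/-! ### Extension by zero and the entries of `M3` -/

open Classical in
/-- The rotation invariant function on triples given by a function on orbits of triangles,
extended by zero outside the hexagon. -/
noncomputable def extendZero {s : ℤ} {a : ℕ} (F : TriangleOrbit s a → ℚ) (t : ℤ × ℤ × ℤ) : ℚ :=
  if h : InHexagon s a t then F (orbitOf (Triangle.ofCoords t h)) else 0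

theorem extendZero_of_mem {s : ℤ} {a : ℕ} (F : TriangleOrbit s a → ℚ) {t : ℤ × ℤ × ℤ}
    (h : InHexagon s a t) : extendZero F t = F (orbitOf (Triangle.ofCoords t h)) := by
  rw [extendZero, dif_pos h]

theorem extendZero_coords {s : ℤ} {a : ℕ} (F : TriangleOrbit s a → ℚ) (t : Triangle s a) :
    extendZero F t.coords = F (orbitOf t) := by
  rw [extendZero_of_mem F t.coords_inHexagon, Triangle.ofCoords_coords]

theorem extendZero_of_not {s : ℤ} {a : ℕ} (F : TriangleOrbit s a → ℚ) {t : ℤ × ℤ × ℤ}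
    (h : ¬ InHexagon s a t) : extendZero F t = 0 := by
  rw [extendZero, dif_neg h]

theorem extendZero_rotateCoords {s : ℤ} {a : ℕ} (F : TriangleOrbit s a → ℚ) (t : ℤ × ℤ × ℤ) :
    extendZero F (rotateCoords t) = extendZero F t := by
  by_cases h : InHexagon s a t
  · have h' := extendZero_coords F (rho s a (Triangle.ofCoords t h))
    rw [orbitOf_rho, ← extendZero_coords F, coords_rho, Triangle.coords_ofCoords] at h'
    exact h'
  · rw [extendZero_of_not F h, extendZero_of_not]
    contrapose! h
    simp only [InHexagon, rotateCoords] at h ⊢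
    omega

theorem sum_indicator_eq_extendZero {s : ℤ} {a : ℕ} (F : TriangleOrbit s a → ℚ)
    (w : ℤ × ℤ × ℤ) [DecidableEq (ℤ × ℤ × ℤ)] :
    ∑ t : Triangle s a, (if t.coords = w then F (orbitOf t) else 0) = extendZero F w := by
  by_cases h : InHexagon s a w
  · rw [Finset.sum_eq_single (Triangle.ofCoords w h)]
    · rw [if_pos (Triangle.coords_ofCoords w h), extendZero_of_mem F h]
    · intro t _ ht
      exact if_neg fun h' => ht (Triangle.coords_injective h')
    · simp
  · rw [extendZero_of_not F h]
    refine Finset.sum_eq_zero fun t _ => if_neg ?_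
    rintro rfl
    exact h t.coords_inHexagon

/-- The rotation fixes no `∇` triangle, as -1 is not divisible by 3. Hence each edge orbit at the
orbit of `t` has exactly one representative ending at `t` itself. -/
theorem ncard_edgesBetween_eq_left {a : ℕ} (t : Nabla a) (c : DeltaOrbit a) :
    (edgesBetween (orbitOf t) c).ncard = {u : Delta a | Adjacent t u ∧ orbitOf u = c}.ncard := by
  symm
  refine Set.ncard_congr (fun u hu => edgeOrbitOf (ZEdge.mk t u hu.1)) ?_ ?_ ?_
  · intro u hu
    exact ⟨_, rfl, rfl, hu.2⟩
  · intro u u' hu hu' h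
    rcases (edgeOrbitOf_eq_iff _ _).1 h with h | h | h
    · exact (congrArg ZEdge.delta h).symm
    · exact absurd (congrArg ZEdge.nabla h).symm (rho_ne_self (by norm_num) t)
    · exact absurd (congrArg ZEdge.nabla h).symm (rho_rho_ne_self (by norm_num) t)
  · intro q hq
    obtain ⟨e, rfl, h1, h2⟩ := (mem_edgesBetween _ _ _).1 hq
    have key : ∀ e' : ZEdge a, e'.nabla = t → orbitOf e'.delta = c →
        edgeOrbitOf e' = edgeOrbitOf e → ∃ u, ∃ hu : u ∈ {u : Delta a | Adjacent t u ∧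
          orbitOf u = c}, edgeOrbitOf (ZEdge.mk t u hu.1) = edgeOrbitOf e := by
      rintro e' rfl h3 h4
      exact ⟨e'.delta, ⟨e'.adjacent, h3⟩, h4⟩
    rcases (orbitOf_eq_iff _ _).1 h1 with h1 | h1 | h1
    · exact key e h1.symm h2 rfl
    · exact key (rhoEdge a e) h1.symm ((orbitOf_rho _).trans h2)
        ((edgeOrbitOf_eq_iff _ _).2 (Or.inr (Or.inr rfl)))
    · exact key (rhoEdge a (rhoEdge a e)) h1.symm
        (((orbitOf_rho _).trans (orbitOf_rho _)).trans h2)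
        ((edgeOrbitOf_eq_iff _ _).2 (Or.inr (Or.inl rfl)))

theorem ncard_edgesBetween_eq_right {a : ℕ} (r : NablaOrbit a) (u : Delta a) :
    (edgesBetween r (orbitOf u)).ncard = {t : Nabla a | Adjacent t u ∧ orbitOf t = r}.ncard := by
  symm
  refine Set.ncard_congr (fun t ht => edgeOrbitOf (ZEdge.mk t u ht.1)) ?_ ?_ ?_
  · intro t ht
    exact ⟨_, rfl, ht.2, rfl⟩
  · intro t t' ht ht' h
    rcases (edgeOrbitOf_eq_iff _ _).1 h with h | h | h
    · exact (congrArg ZEdge.nabla h).symm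
    · exact absurd (congrArg ZEdge.delta h).symm (rho_ne_self (by norm_num) u)
    · exact absurd (congrArg ZEdge.delta h).symm (rho_rho_ne_self (by norm_num) u)
  · intro q hq
    obtain ⟨e, rfl, h2, h1⟩ := (mem_edgesBetween _ _ _).1 hq
    have key : ∀ e' : ZEdge a, e'.delta = u → orbitOf e'.nabla = r →
        edgeOrbitOf e' = edgeOrbitOf e → ∃ t, ∃ ht : t ∈ {t : Nabla a | Adjacent t u ∧
          orbitOf t = r}, edgeOrbitOf (ZEdge.mk t u ht.1) = edgeOrbitOf e := by
      rintro e' rfl h3 h4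
      exact ⟨e'.nabla, ⟨e'.adjacent, h3⟩, h4⟩
    rcases (orbitOf_eq_iff _ _).1 h1 with h1 | h1 | h1
    · exact key e h1.symm h2 rfl
    · exact key (rhoEdge a e) h1.symm ((orbitOf_rho _).trans h2)
        ((edgeOrbitOf_eq_iff _ _).2 (Or.inr (Or.inr rfl)))
    · exact key (rhoEdge a (rhoEdge a e)) h1.symm
        (((orbitOf_rho _).trans (orbitOf_rho _)).trans h2)
        ((edgeOrbitOf_eq_iff _ _).2 (Or.inr (Or.inl rfl)))

/-- The sum of `f` over the triples below `t` in one coordinate. -/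
def sumBelow (f : ℤ × ℤ × ℤ → ℚ) (t : ℤ × ℤ × ℤ) : ℚ :=
  f (t.1 - 1, t.2.1, t.2.2) + f (t.1, t.2.1 - 1, t.2.2) + f (t.1, t.2.1, t.2.2 - 1)

/-- The sum of `f` over the triples above `t` in one coordinate. -/
def sumAbove (f : ℤ × ℤ × ℤ → ℚ) (t : ℤ × ℤ × ℤ) : ℚ :=
  f (t.1 + 1, t.2.1, t.2.2) + f (t.1, t.2.1 + 1, t.2.2) + f (t.1, t.2.1, t.2.2 + 1)

theorem ite_or_or {P Q R : Prop} [Decidable P] [Decidable Q] [Decidable R]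
    [Decidable (P ∨ Q ∨ R)] (h1 : P → ¬ Q) (h2 : P → ¬ R) (h3 : Q → ¬ R) (x : ℚ) :
    (if P ∨ Q ∨ R then x else 0) =
      (if P then x else 0) + (if Q then x else 0) + (if R then x else 0) := by
  by_cases hP : P <;> by_cases hQ : Q <;> by_cases hR : R <;> simp_all

theorem M3_apply_orbitOf_left {a : ℕ} (t : Nabla a) (c : DeltaOrbit a) :
    M3 a (orbitOf t) c = sumBelow (extendZero (Pi.single c 1)) t.coords := by
  classical
  rw [M3, Matrix.of_apply, ncard_edgesBetween_eq_left, Set.ncard_eq_toFinset_card',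
    Finset.card_eq_sum_ones, Set.toFinset_ofPred, Finset.sum_filter, sumBelow,
    ← sum_indicator_eq_extendZero, ← sum_indicator_eq_extendZero, ← sum_indicator_eq_extendZero,
    ← Finset.sum_add_distrib, ← Finset.sum_add_distrib]
  push_cast
  refine Finset.sum_congr rfl fun u _ => ?_
  have := ite_or_or (P := u.coords = (t.coords.1 - 1, t.coords.2.1, t.coords.2.2))
    (Q := u.coords = (t.coords.1, t.coords.2.1 - 1, t.coords.2.2))
    (R := u.coords = (t.coords.1, t.coords.2.1, t.coords.2.2 - 1))
    (by intro h h'; rw [h, Prod.mk.injEq] at h'; omega)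
    (by intro h h'; rw [h, Prod.mk.injEq] at h'; omega)
    (by intro h h'; rw [h, Prod.mk.injEq, Prod.mk.injEq] at h'; omega)
    ((Pi.single c 1 : DeltaOrbit a → ℚ) (orbitOf u))
  rw [← this, ite_and, Pi.single_apply]
  exact if_congr (adjacent_iff_left t u) rfl rfl

theorem M3_apply_orbitOf_right {a : ℕ} (r : NablaOrbit a) (u : Delta a) :
    M3 a r (orbitOf u) = sumAbove (extendZero (Pi.single r 1)) u.coords := by
  classical
  rw [M3, Matrix.of_apply, ncard_edgesBetween_eq_right, Set.ncard_eq_toFinset_card',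
    Finset.card_eq_sum_ones, Set.toFinset_ofPred, Finset.sum_filter, sumAbove,
    ← sum_indicator_eq_extendZero, ← sum_indicator_eq_extendZero, ← sum_indicator_eq_extendZero,
    ← Finset.sum_add_distrib, ← Finset.sum_add_distrib]
  push_cast
  refine Finset.sum_congr rfl fun t _ => ?_
  have := ite_or_or (P := t.coords = (u.coords.1 + 1, u.coords.2.1, u.coords.2.2))
    (Q := t.coords = (u.coords.1, u.coords.2.1 + 1, u.coords.2.2))
    (R := t.coords = (u.coords.1, u.coords.2.1, u.coords.2.2 + 1))
    (by intro h h'; rw [h, Prod.mk.injEq] at h'; omega)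
    (by intro h h'; rw [h, Prod.mk.injEq] at h'; omega)
    (by intro h h'; rw [h, Prod.mk.injEq, Prod.mk.injEq] at h'; omega)
    ((Pi.single r 1 : NablaOrbit a → ℚ) (orbitOf t))
  rw [← this, ite_and, Pi.single_apply]
  exact if_congr (adjacent_iff_right t u) rfl rfl

/-! ### The fundamental rhombus -/

/-- The `∇` triangle of the lozenge `(p, q)` of the fundamental rhombus. -/
def nablaCell {a : ℕ} (c : Fin a × Fin a) : Nabla a :=
  Triangle.ofCoords ((c.1 : ℤ) - (c.2 : ℕ), ((c.2 : ℕ) : ℤ), -1 - ((c.1 : ℕ) : ℤ)) (by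
    have := c.1.2
    have := c.2.2
    simp only [InHexagon]
    omega)

/-- The `Δ` triangle of the lozenge `(p, q)` of the fundamental rhombus. -/
def deltaCell {a : ℕ} (c : Fin a × Fin a) : Delta a :=
  Triangle.ofCoords ((c.1 : ℤ) - (c.2 : ℕ) - 1, ((c.2 : ℕ) : ℤ), -1 - ((c.1 : ℕ) : ℤ)) (by
    have := c.1.2
    have := c.2.2
    simp only [InHexagon]
    omega)

theorem coords_nablaCell {a : ℕ} (c : Fin a × Fin a) :
    (nablaCell c).coords = ((c.1 : ℤ) - (c.2 : ℕ), ((c.2 : ℕ) : ℤ), -1 - ((c.1 : ℕ) : ℤ)) := rfl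

theorem coords_deltaCell {a : ℕ} (c : Fin a × Fin a) :
    (deltaCell c).coords = ((c.1 : ℤ) - (c.2 : ℕ) - 1, ((c.2 : ℕ) : ℤ), -1 - ((c.1 : ℕ) : ℤ)) :=
  rfl

theorem orbitOf_eq_iff_coords {s : ℤ} {a : ℕ} (t u : Triangle s a) :
    orbitOf t = orbitOf u ↔ u.coords = t.coords ∨ u.coords = rotateCoords t.coords ∨
      u.coords = rotateCoords (rotateCoords t.coords) := by
  rw [orbitOf_eq_iff, ← coords_rho, ← coords_rho, Triangle.coords_injective.eq_iff,
    Triangle.coords_injective.eq_iff, Triangle.coords_injective.eq_iff]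

/-- With coordinate sum -1 the three coordinates are neither all nonnegative nor all negative. A
cyclic word of three signs using both has exactly one place where a nonnegative entry precedes a
negative one; rotating that place to the last two coordinates selects the cell. -/
theorem orbitOf_nablaCell_bijective (a : ℕ) :
    Function.Bijective fun c : Fin a × Fin a => orbitOf (nablaCell c) := by
  constructor
  · rintro ⟨p, q⟩ ⟨p', q'⟩ h
    simp only [orbitOf_eq_iff_coords, coords_nablaCell, rotateCoords, Prod.ext_iff] at h
    ext <;> simp only <;> omega
  · intro r
    obtain ⟨t, rfl⟩ := exists_orbitOf_eq r
    have ht := t.coords_inHexagon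
    simp only [InHexagon] at ht
    by_cases h1 : 0 ≤ t.coords.2.1 ∧ t.coords.2.2 < 0
    · refine ⟨(⟨(-1 - t.coords.2.2).toNat, by omega⟩, ⟨t.coords.2.1.toNat, by omega⟩), ?_⟩
      simp only [orbitOf_eq_iff_coords, coords_nablaCell, rotateCoords, Prod.ext_iff]
      omega
    by_cases h2 : 0 ≤ t.coords.2.2 ∧ t.coords.1 < 0
    · refine ⟨(⟨(-1 - t.coords.1).toNat, by omega⟩, ⟨t.coords.2.2.toNat, by omega⟩), ?_⟩
      simp only [orbitOf_eq_iff_coords, coords_nablaCell, rotateCoords, Prod.ext_iff]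
      omega
    · refine ⟨(⟨(-1 - t.coords.2.1).toNat, by omega⟩, ⟨t.coords.1.toNat, by omega⟩), ?_⟩
      simp only [orbitOf_eq_iff_coords, coords_nablaCell, rotateCoords, Prod.ext_iff]
      omega

theorem orbitOf_deltaCell_bijective (a : ℕ) :
    Function.Bijective fun c : Fin a × Fin a => orbitOf (deltaCell c) := by
  constructor
  · rintro ⟨p, q⟩ ⟨p', q'⟩ h
    simp only [orbitOf_eq_iff_coords, coords_deltaCell, rotateCoords, Prod.ext_iff] at h
    ext <;> simp only <;> omega
  · intro r
    obtain ⟨t, rfl⟩ := exists_orbitOf_eq r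
    have ht := t.coords_inHexagon
    simp only [InHexagon] at ht
    by_cases h1 : 0 ≤ t.coords.2.1 ∧ t.coords.2.2 < 0
    · refine ⟨(⟨(-1 - t.coords.2.2).toNat, by omega⟩, ⟨t.coords.2.1.toNat, by omega⟩), ?_⟩
      simp only [orbitOf_eq_iff_coords, coords_deltaCell, rotateCoords, Prod.ext_iff]
      omega
    by_cases h2 : 0 ≤ t.coords.2.2 ∧ t.coords.1 < 0
    · refine ⟨(⟨(-1 - t.coords.1).toNat, by omega⟩, ⟨t.coords.2.2.toNat, by omega⟩), ?_⟩
      simp only [orbitOf_eq_iff_coords, coords_deltaCell, rotateCoords, Prod.ext_iff]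
      omega
    · refine ⟨(⟨(-1 - t.coords.2.1).toNat, by omega⟩, ⟨t.coords.1.toNat, by omega⟩), ?_⟩
      simp only [orbitOf_eq_iff_coords, coords_deltaCell, rotateCoords, Prod.ext_iff]
      omega

/-- The lozenges of the fundamental rhombus correspond to the `∇` orbits. -/
noncomputable def nablaEquiv (a : ℕ) : Fin a × Fin a ≃ NablaOrbit a :=
  Equiv.ofBijective _ (orbitOf_nablaCell_bijective a)

/-- The lozenges of the fundamental rhombus correspond to the `Δ` orbits. -/
noncomputable def deltaEquiv (a : ℕ) : Fin a × Fin a ≃ DeltaOrbit a :=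
  Equiv.ofBijective _ (orbitOf_deltaCell_bijective a)

theorem nablaEquiv_apply {a : ℕ} (c : Fin a × Fin a) :
    nablaEquiv a c = orbitOf (nablaCell c) := rfl

theorem deltaEquiv_apply {a : ℕ} (c : Fin a × Fin a) :
    deltaEquiv a c = orbitOf (deltaCell c) := rfl

/-- The number of edges of `Z₃` from the `Δ` triangle of the lozenge `(p, q)` to the `∇` triangle
of the lozenge `(p', q')`. -/
def rhombusEntry (p' q' p q : ℕ) : ℚ :=
  (if p' = p ∧ q' = q then 1 else 0) +
    (if (p = 0 ∧ p' = q ∧ q' = 0) ∨ (p' + 1 = p ∧ q' = q) then 1 else 0) +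
    (if p' = p ∧ q' = q + 1 then 1 else 0)

/-- The matrix `M3` indexed by the lozenges of the fundamental rhombus. -/
def rhombusMatrix (a : ℕ) : Matrix (Fin a × Fin a) (Fin a × Fin a) ℚ :=
  Matrix.of fun c' c => rhombusEntry c'.1 c'.2 c.1 c.2

theorem extendZero_single_nablaCell {a : ℕ} (c' c : Fin a × Fin a) :
    extendZero (Pi.single (nablaEquiv a c') 1) (nablaCell c).coords =
      if (c'.1 : ℕ) = c.1 ∧ (c'.2 : ℕ) = c.2 then 1 else 0 := by
  rw [extendZero_coords, Pi.single_apply, ← nablaEquiv_apply]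
  refine if_congr ?_ rfl rfl
  rw [(nablaEquiv a).injective.eq_iff, Prod.ext_iff, Fin.ext_iff, Fin.ext_iff]
  omega

theorem submatrix_M3_eq_rhombusMatrix (a : ℕ) :
    (M3 a).submatrix (nablaEquiv a) (deltaEquiv a) = rhombusMatrix a := by
  ext c' c
  obtain ⟨⟨p, hp⟩, ⟨q, hq⟩⟩ := c
  rw [Matrix.submatrix_apply, deltaEquiv_apply, M3_apply_orbitOf_right, sumAbove, rhombusMatrix,
    Matrix.of_apply, rhombusEntry, coords_deltaCell]
  have h1 := extendZero_single_nablaCell c' (⟨p, hp⟩, ⟨q, hq⟩)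
  rw [coords_nablaCell] at h1
  have e1 : (p : ℤ) - q - 1 + 1 = p - q := by ring
  simp only [e1] at h1 ⊢
  rw [h1, add_right_comm]
  congr 1
  · congr 1
    -- On the side `p = 0` the neighbour leaves the rhombus, and a rotation brings it back as the
    -- cell `(q, 0)`.
    rcases Nat.eq_zero_or_pos p with rfl | hp0
    · have h2 := extendZero_single_nablaCell c' (⟨q, hq⟩, ⟨0, hp⟩)
      rw [← extendZero_rotateCoords, coords_nablaCell, rotateCoords] at h2
      simp only [Nat.cast_zero, sub_zero] at h2
      rw [show ((0 : ℕ) : ℤ) - q - 1 = -1 - q by push_cast; ring,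
        show (-1 : ℤ) - (0 : ℕ) + 1 = 0 by norm_num, h2]
      refine if_congr ?_ rfl rfl
      omega
    · have h2 := extendZero_single_nablaCell c' (⟨p - 1, by omega⟩, ⟨q, hq⟩)
      rw [coords_nablaCell] at h2
      simp only [Nat.cast_sub (show 1 ≤ p from hp0), Nat.cast_one] at h2
      rw [show (p : ℤ) - q - 1 = p - 1 - q by ring, show (-1 : ℤ) - p + 1 = -1 - (p - 1) by ring,
        h2]
      refine if_congr ?_ rfl rfl
      omega
  · by_cases hq1 : q + 1 < a
    · have h2 := extendZero_single_nablaCell c' (⟨p, hp⟩, ⟨q + 1, hq1⟩)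
      rw [coords_nablaCell] at h2
      simp only [Nat.cast_add, Nat.cast_one] at h2
      rw [show (p : ℤ) - q - 1 = p - (q + 1) by ring, h2]
    · rw [extendZero_of_not, if_neg]
      · have := c'.2.2
        omega
      · simp only [InHexagon]
        omega

theorem absDet_M3_eq (a : ℕ) : absDet (M3 a) = |(rhombusMatrix a).det| := by
  rw [absDet_eq (M3 a) ((nablaEquiv a).symm.trans (deltaEquiv a)),
    ← submatrix_M3_eq_rhombusMatrix, ← Matrix.det_submatrix_equiv_self (nablaEquiv a)]
  congr 2
  ext c' c
  simp

/-! ### Raising and lowering operators -/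

theorem extendZero_add {s : ℤ} {a : ℕ} (F G : TriangleOrbit s a → ℚ) (t : ℤ × ℤ × ℤ) :
    extendZero (F + G) t = extendZero F t + extendZero G t := by
  by_cases h : InHexagon s a t
  · simp only [extendZero_of_mem _ h, Pi.add_apply]
  · simp only [extendZero_of_not _ h, add_zero]

theorem extendZero_smul {s : ℤ} {a : ℕ} (x : ℚ) (F : TriangleOrbit s a → ℚ) (t : ℤ × ℤ × ℤ) :
    extendZero (x • F) t = x * extendZero F t := by
  by_cases h : InHexagon s a t
  · simp only [extendZero_of_mem _ h, Pi.smul_apply, smul_eq_mul]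
  · simp only [extendZero_of_not _ h, mul_zero]

/-- The structure constant of the lowering operator, `(a + i) (a - i)`. -/
def loweringCoeff (a : ℕ) (i : ℤ) : ℚ := (a + i) * (a - i)

/-- The weighted sum of `f` over the triples above `t` in one coordinate. -/
def weightedSumAbove (a : ℕ) (f : ℤ × ℤ × ℤ → ℚ) (t : ℤ × ℤ × ℤ) : ℚ :=
  loweringCoeff a (t.1 + 1) * f (t.1 + 1, t.2.1, t.2.2) +
    loweringCoeff a (t.2.1 + 1) * f (t.1, t.2.1 + 1, t.2.2) +
    loweringCoeff a (t.2.2 + 1) * f (t.1, t.2.1, t.2.2 + 1)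

theorem sumBelow_rotateCoords {f : ℤ × ℤ × ℤ → ℚ} (hf : ∀ t, f (rotateCoords t) = f t)
    (t : ℤ × ℤ × ℤ) : sumBelow f (rotateCoords t) = sumBelow f t := by
  simp only [sumBelow, rotateCoords]
  rw [← hf (t.1 - 1, t.2.1, t.2.2), ← hf (t.1, t.2.1 - 1, t.2.2), ← hf (t.1, t.2.1, t.2.2 - 1)]
  simp only [rotateCoords]
  ring

theorem weightedSumAbove_rotateCoords (a : ℕ) {f : ℤ × ℤ × ℤ → ℚ}
    (hf : ∀ t, f (rotateCoords t) = f t) (t : ℤ × ℤ × ℤ) :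
    weightedSumAbove a f (rotateCoords t) = weightedSumAbove a f t := by
  simp only [weightedSumAbove, rotateCoords]
  rw [← hf (t.1 + 1, t.2.1, t.2.2), ← hf (t.1, t.2.1 + 1, t.2.2), ← hf (t.1, t.2.1, t.2.2 + 1)]
  simp only [rotateCoords]
  ring

theorem apply_coords_eq_of_orbitOf_eq {s : ℤ} {a : ℕ} {f : ℤ × ℤ × ℤ → ℚ}
    (hf : ∀ t, f (rotateCoords t) = f t) {t u : Triangle s a} (h : orbitOf t = orbitOf u) :
    f t.coords = f u.coords := by
  rcases (orbitOf_eq_iff_coords t u).1 h with h | h | h <;> simp only [h, hf]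

/-- The raising operator on functions on orbits. -/
noncomputable def raise (a : ℕ) (s s' : ℤ) :
    (TriangleOrbit s a → ℚ) →ₗ[ℚ] (TriangleOrbit s' a → ℚ) where
  toFun F r := sumBelow (extendZero F) (exists_orbitOf_eq r).choose.coords
  map_add' F G := by
    ext r
    simp only [sumBelow, extendZero_add, Pi.add_apply]
    ring
  map_smul' x F := by
    ext r
    simp only [sumBelow, extendZero_smul, Pi.smul_apply, smul_eq_mul, RingHom.id_apply]
    ring

/-- The lowering operator on functions on orbits. -/
noncomputable def lower (a : ℕ) (s s' : ℤ) :
    (TriangleOrbit s a → ℚ) →ₗ[ℚ] (TriangleOrbit s' a → ℚ) where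
  toFun F r := weightedSumAbove a (extendZero F) (exists_orbitOf_eq r).choose.coords
  map_add' F G := by
    ext r
    simp only [weightedSumAbove, extendZero_add, Pi.add_apply]
    ring
  map_smul' x F := by
    ext r
    simp only [weightedSumAbove, extendZero_smul, Pi.smul_apply, smul_eq_mul, RingHom.id_apply]
    ring

theorem raise_apply_orbitOf (a : ℕ) (s s' : ℤ) (F : TriangleOrbit s a → ℚ) (t : Triangle s' a) :
    raise a s s' F (orbitOf t) = sumBelow (extendZero F) t.coords :=
  apply_coords_eq_of_orbitOf_eq (f := sumBelow (extendZero F))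
    (sumBelow_rotateCoords (extendZero_rotateCoords F)) (exists_orbitOf_eq (orbitOf t)).choose_spec

theorem lower_apply_orbitOf (a : ℕ) (s s' : ℤ) (F : TriangleOrbit s a → ℚ) (t : Triangle s' a) :
    lower a s s' F (orbitOf t) = weightedSumAbove a (extendZero F) t.coords :=
  apply_coords_eq_of_orbitOf_eq (f := weightedSumAbove a (extendZero F))
    (weightedSumAbove_rotateCoords a (extendZero_rotateCoords F))
    (exists_orbitOf_eq (orbitOf t)).choose_spec

theorem extendZero_raise {a : ℕ} {s s' : ℤ} (F : TriangleOrbit s a → ℚ) {t : ℤ × ℤ × ℤ}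
    (h : InHexagon s' a t) : extendZero (raise a s s' F) t = sumBelow (extendZero F) t := by
  rw [extendZero_of_mem _ h, raise_apply_orbitOf, Triangle.coords_ofCoords]

/-- Extending by zero stays compatible with lowering just below the hexagon: the only term that
could survive there carries the coefficient `loweringCoeff a (-a) = 0`. -/
theorem extendZero_lower {a : ℕ} {s s' : ℤ} (F : TriangleOrbit s a → ℚ) {t : ℤ × ℤ × ℤ}
    (h : InHexagon s' a t ∨ t.1 = -a - 1 ∨ t.2.1 = -a - 1 ∨ t.2.2 = -a - 1) :
    extendZero (lower a s s' F) t = weightedSumAbove a (extendZero F) t := by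
  by_cases h' : InHexagon s' a t
  · rw [extendZero_of_mem _ h', lower_apply_orbitOf, Triangle.coords_ofCoords]
  · have hc : loweringCoeff a (-a) = 0 := by simp [loweringCoeff]
    rw [extendZero_of_not _ h', weightedSumAbove]
    rcases h with h | h | h | h
    · exact absurd h h'
    · rw [extendZero_of_not (t := (t.1, t.2.1 + 1, t.2.2)),
        extendZero_of_not (t := (t.1, t.2.1, t.2.2 + 1)), h, sub_add_cancel, hc]
      · ring
      all_goals simp only [InHexagon]; omega
    · rw [extendZero_of_not (t := (t.1 + 1, t.2.1, t.2.2)),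
        extendZero_of_not (t := (t.1, t.2.1, t.2.2 + 1)), h, sub_add_cancel, hc]
      · ring
      all_goals simp only [InHexagon]; omega
    · rw [extendZero_of_not (t := (t.1 + 1, t.2.1, t.2.2)),
        extendZero_of_not (t := (t.1, t.2.1 + 1, t.2.2)), h, sub_add_cancel, hc]
      · ring
      all_goals simp only [InHexagon]; omega

theorem loweringCoeff_mul_extendZero_raise {a : ℕ} {s s' : ℤ} (F : TriangleOrbit s a → ℚ)
    {t : ℤ × ℤ × ℤ} (i : ℤ) (h : InHexagon s' a t ∨ i = a) :
    loweringCoeff a i * extendZero (raise a s s' F) t =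
      loweringCoeff a i * sumBelow (extendZero F) t := by
  rcases h with h | h
  · rw [extendZero_raise F h]
  · simp [h, loweringCoeff]

/-- The sl₂ relation. Mixed terms, which move two different coordinates, cancel. Each coordinate `i`
contributes `loweringCoeff a (i + 1) - loweringCoeff a i = -(2 * i + 1)`, and these add up to `-(2 *
s + 3)`. -/
theorem lower_raise_apply {a : ℕ} (s s' s'' : ℤ) (hs' : s' = s + 1) (hs'' : s'' = s - 1)
    (F : TriangleOrbit s a → ℚ) :
    lower a s' s (raise a s s' F) = raise a s'' s (lower a s s'' F) + (-(2 * (s : ℚ) + 3)) • F := by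
  ext r
  obtain ⟨⟨i, j, k⟩, ht⟩ : ∃ t : ℤ × ℤ × ℤ, ∃ h : InHexagon s a t,
      orbitOf (Triangle.ofCoords t h) = r := by
    obtain ⟨t, rfl⟩ := exists_orbitOf_eq r
    exact ⟨t.coords, t.coords_inHexagon, rfl⟩
  obtain ⟨h, rfl⟩ := ht
  rw [Pi.add_apply, Pi.smul_apply, smul_eq_mul, lower_apply_orbitOf, raise_apply_orbitOf,
    ← extendZero_coords F, Triangle.coords_ofCoords, weightedSumAbove, sumBelow]
  have h0 := h
  simp only [InHexagon] at h0
  have hs : (s : ℚ) = i + j + k := by exact_mod_cast h0.2.2.2.symm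
  rw [loweringCoeff_mul_extendZero_raise, loweringCoeff_mul_extendZero_raise,
    loweringCoeff_mul_extendZero_raise, extendZero_lower, extendZero_lower, extendZero_lower]
  · simp only [sumBelow, weightedSumAbove, add_sub_cancel_right, sub_add_cancel, loweringCoeff, hs]
    push_cast
    ring
  all_goals simp only [InHexagon]; omega

/-! ### The determinant of the product of the two operators -/

/-- Sylvester's determinant identity, homogenised in `x`; the powers account for the different sizes
of the two products. -/
theorem pow_mul_det_add_mul_comm {m n : Type*} [Fintype m] [Fintype n] [DecidableEq m]
    [DecidableEq n] (A : Matrix m n ℚ) (B : Matrix n m ℚ) {x : ℚ} (hx : x ≠ 0) :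
    x ^ Fintype.card n * (x • (1 : Matrix m m ℚ) + A * B).det =
      x ^ Fintype.card m * (x • (1 : Matrix n n ℚ) + B * A).det := by
  have h1 : x • (1 : Matrix m m ℚ) + A * B = x • (1 + (x⁻¹ • A) * B) := by
    rw [Matrix.smul_mul, smul_add, smul_smul, mul_inv_cancel₀ hx, one_smul]
  have h2 : x • (1 : Matrix n n ℚ) + B * A = x • (1 + B * (x⁻¹ • A)) := by
    rw [Matrix.mul_smul, smul_add, smul_smul, mul_inv_cancel₀ hx, one_smul]
  rw [h1, h2, Matrix.det_smul, Matrix.det_smul, Matrix.det_one_add_mul_comm]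
  ring

/-- The matrix of the raising operator. -/
noncomputable def raiseMatrix (a : ℕ) (s s' : ℤ) :
    Matrix (TriangleOrbit s' a) (TriangleOrbit s a) ℚ :=
  LinearMap.toMatrix' (raise a s s')

/-- The matrix of the lowering operator. -/
noncomputable def lowerMatrix (a : ℕ) (s s' : ℤ) :
    Matrix (TriangleOrbit s' a) (TriangleOrbit s a) ℚ :=
  LinearMap.toMatrix' (lower a s s')

theorem lowerMatrix_mul_raiseMatrix {a : ℕ} (s s' s'' : ℤ) (hs' : s' = s + 1)
    (hs'' : s'' = s - 1) :
    lowerMatrix a s' s * raiseMatrix a s s' =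
      raiseMatrix a s'' s * lowerMatrix a s s'' + (-(2 * (s : ℚ) + 3)) • 1 := by
  have h : lower a s' s ∘ₗ raise a s s' =
      raise a s'' s ∘ₗ lower a s s'' + (-(2 * (s : ℚ) + 3)) • LinearMap.id :=
    LinearMap.ext fun F => lower_raise_apply s s' s'' hs' hs'' F
  have := congrArg LinearMap.toMatrix' h
  rwa [map_add, map_smul, LinearMap.toMatrix'_comp, LinearMap.toMatrix'_comp,
    LinearMap.toMatrix'_id] at this

/-- The determinant of `x` plus the product of the two operators, in coordinate sum `s`. -/
noncomputable def weightDet (a : ℕ) (s : ℤ) (x : ℚ) : ℚ :=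
  (x • 1 + lowerMatrix a (s + 1) s * raiseMatrix a s (s + 1)).det

theorem weightDet_eq {a : ℕ} {s s' : ℤ} (h : s' = s + 1) (x : ℚ) :
    weightDet a s x = (x • 1 + lowerMatrix a s' s * raiseMatrix a s s').det := by
  subst h
  rfl

/-- The commutation relation turns lowering after raising into raising after lowering plus a scalar,
and Sylvester's identity moves the latter product one weight down. The exponent is the difference of
the dimensions. -/
theorem weightDet_eq_mul_weightDet {a : ℕ} {s s' : ℤ} (hs : s' = s - 1) {x y : ℚ} (hy : 0 < y)
    (hxy : y = x - (2 * s + 3)) :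
    weightDet a s x = y ^ ((Fintype.card (TriangleOrbit s a) : ℤ) -
      Fintype.card (TriangleOrbit s' a)) * weightDet a s' y := by
  have e : x • (1 : Matrix (TriangleOrbit s a) (TriangleOrbit s a) ℚ) +
      (raiseMatrix a s' s * lowerMatrix a s s' + (-(2 * (s : ℚ) + 3)) • 1) =
      y • 1 + raiseMatrix a s' s * lowerMatrix a s s' := by
    rw [hxy, sub_eq_add_neg, add_smul]
    abel
  rw [zpow_sub₀ hy.ne', zpow_natCast, zpow_natCast, div_mul_eq_mul_div,
    eq_div_iff (pow_ne_zero _ hy.ne'), mul_comm, weightDet,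
    lowerMatrix_mul_raiseMatrix s (s + 1) s' rfl hs, e, pow_mul_det_add_mul_comm _ _ hy.ne',
    weightDet_eq (show s = s' + 1 by omega)]

/-- At sum `-2 - m` the shift is `2 * m + 1`, so starting from 0 the accumulated scalars are sums of
consecutive odd numbers, that is, squares. -/
theorem weightDet_neg_two_eq_prod (a M : ℕ) :
    weightDet a (-2) 0 = (∏ m ∈ Finset.range M, ((m + 1 : ℚ) ^ 2) ^
      ((Fintype.card (TriangleOrbit (-2 - m) a) : ℤ) -
        Fintype.card (TriangleOrbit (-3 - m) a))) *
      weightDet a (-2 - M) ((M : ℚ) ^ 2) := by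
  induction M with
  | zero => simp
  | succ M ih =>
    rw [ih, Finset.prod_range_succ, mul_assoc,
      weightDet_eq_mul_weightDet (s := -2 - M) (s' := -3 - M) (y := (M + 1 : ℚ) ^ 2)
        (by ring) (by positivity) (by push_cast; ring)]
    rw [show (-2 : ℤ) - ((M + 1 : ℕ) : ℤ) = -3 - M by push_cast; ring]
    push_cast
    rfl

theorem isEmpty_triangleOrbit {s : ℤ} {a : ℕ} (h : s < -(3 * a)) :
    IsEmpty (TriangleOrbit s a) := by
  refine ⟨fun r => ?_⟩
  obtain ⟨t, -⟩ := exists_orbitOf_eq r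
  have := t.coords_inHexagon
  simp only [InHexagon] at this
  omega

theorem weightDet_eq_one {a : ℕ} {s : ℤ} (h : s < -(3 * a)) (x : ℚ) : weightDet a s x = 1 := by
  have := isEmpty_triangleOrbit h
  exact Matrix.det_isEmpty

/-! ### The determinant of the rhombus matrix -/

theorem raiseMatrix_eq_M3 (a : ℕ) : raiseMatrix a (-2) (-1) = M3 a := by
  ext r c
  obtain ⟨t, rfl⟩ := exists_orbitOf_eq r
  rw [M3_apply_orbitOf_left, raiseMatrix, LinearMap.toMatrix'_apply, ← raise_apply_orbitOf]

/-- The squared length of a basis vector. -/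
def vectorNorm (a : ℕ) (i : ℤ) : ℚ :=
  ((a + i).toNat.factorial : ℚ) / ((a - 1 - i).toNat.factorial : ℚ)

/-- The squared length of a tensor product of basis vectors. -/
def tensorNorm (a : ℕ) (t : ℤ × ℤ × ℤ) : ℚ :=
  vectorNorm a t.1 * vectorNorm a t.2.1 * vectorNorm a t.2.2

theorem tensorNorm_rotateCoords (a : ℕ) (t : ℤ × ℤ × ℤ) :
    tensorNorm a (rotateCoords t) = tensorNorm a t := by
  simp only [tensorNorm, rotateCoords]
  ring

theorem vectorNorm_pos (a : ℕ) (i : ℤ) : 0 < vectorNorm a i := by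
  rw [vectorNorm]
  positivity

theorem tensorNorm_pos (a : ℕ) (t : ℤ × ℤ × ℤ) : 0 < tensorNorm a t :=
  mul_pos (mul_pos (vectorNorm_pos a _) (vectorNorm_pos a _)) (vectorNorm_pos a _)

theorem vectorNorm_add_one {a : ℕ} {i : ℤ} (h : -a ≤ i) (h' : i + 1 < a) :
    vectorNorm a (i + 1) = loweringCoeff a (i + 1) * vectorNorm a i := by
  obtain ⟨n, hn⟩ := Int.eq_ofNat_of_zero_le (show 0 ≤ a + i by omega)
  obtain ⟨k, hk⟩ := Int.eq_ofNat_of_zero_le (show 0 ≤ a - 1 - (i + 1) by omega)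
  have e1 : (a : ℤ) + (i + 1) = ((n + 1 : ℕ) : ℤ) := by push_cast; omega
  have e2 : (a : ℤ) - 1 - i = ((k + 1 : ℕ) : ℤ) := by push_cast; omega
  rw [vectorNorm, vectorNorm, loweringCoeff, hn, hk, e1, e2]
  have e3 : (a : ℚ) + ((i + 1 : ℤ) : ℚ) = n + 1 := by exact_mod_cast e1
  have e4 : (a : ℚ) - ((i + 1 : ℤ) : ℚ) = k + 1 := by
    have : (a : ℤ) - (i + 1) = k + 1 := by omega
    exact_mod_cast this
  rw [e3, e4]
  simp only [Int.toNat_natCast, Nat.factorial_succ]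
  push_cast
  have := Nat.factorial_ne_zero k
  field_simp

theorem tensorNorm_mul_weightedSumAbove {a : ℕ} {s s' : ℤ} (F : TriangleOrbit s' a → ℚ)
    {t : ℤ × ℤ × ℤ} (h : InHexagon s a t) :
    tensorNorm a t * weightedSumAbove a (extendZero F) t =
      sumAbove (fun w => tensorNorm a w * extendZero F w) t := by
  rw [weightedSumAbove, sumAbove, mul_add, mul_add]
  simp only [InHexagon] at h
  congr 1
  · congr 1
    · by_cases h1 : t.1 + 1 < a
      · simp only [tensorNorm, vectorNorm_add_one h.1.1 h1]
        ring
      · rw [extendZero_of_not F, mul_zero, mul_zero, mul_zero]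
        simp only [InHexagon]
        omega
    · by_cases h1 : t.2.1 + 1 < a
      · simp only [tensorNorm, vectorNorm_add_one h.2.1.1 h1]
        ring
      · rw [extendZero_of_not F, mul_zero, mul_zero, mul_zero]
        simp only [InHexagon]
        omega
  · by_cases h1 : t.2.2 + 1 < a
    · simp only [tensorNorm, vectorNorm_add_one h.2.2.1.1 h1]
      ring
    · rw [extendZero_of_not F, mul_zero, mul_zero, mul_zero]
      simp only [InHexagon]
      omega

theorem tensorNorm_mul_extendZero_single {s : ℤ} {a : ℕ} (t : Triangle s a) (w : ℤ × ℤ × ℤ) :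
    tensorNorm a w * extendZero (Pi.single (orbitOf t) 1) w =
      tensorNorm a t.coords * extendZero (Pi.single (orbitOf t) 1) w := by
  by_cases h : InHexagon s a w
  · rw [extendZero_of_mem _ h, Pi.single_apply]
    split_ifs with h'
    · rw [← apply_coords_eq_of_orbitOf_eq (tensorNorm_rotateCoords a) h',
        Triangle.coords_ofCoords]
    · simp
  · rw [extendZero_of_not _ h, mul_zero, mul_zero]

/-- Adjointness of lowering and raising for the diagonal form `tensorNorm`, which is rotation
invariant and therefore descends to orbits. -/
theorem lowerMatrix_apply (a : ℕ) (t : Nabla a) (u : Delta a) :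
    tensorNorm a u.coords * lowerMatrix a (-1) (-2) (orbitOf u) (orbitOf t) =
      tensorNorm a t.coords * M3 a (orbitOf t) (orbitOf u) := by
  rw [M3_apply_orbitOf_right, lowerMatrix, LinearMap.toMatrix'_apply, lower_apply_orbitOf,
    tensorNorm_mul_weightedSumAbove _ u.coords_inHexagon]
  simp only [sumAbove, tensorNorm_mul_extendZero_single]
  ring

/-- By adjointness the lowering matrix is the transposed raising matrix with rescaled rows and
columns. The two triangles of a lozenge differ only in the first coordinate, so the scale factors of
each lozenge combine into a single `loweringCoeff`. -/
theorem det_lowerMatrix_mul_raiseMatrix (a : ℕ) :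
    (lowerMatrix a (-1) (-2) * raiseMatrix a (-2) (-1)).det =
      (∏ c : Fin a × Fin a, loweringCoeff a ((c.1 : ℤ) - (c.2 : ℕ))) *
        (rhombusMatrix a).det ^ 2 := by
  rw [raiseMatrix_eq_M3, ← Matrix.det_submatrix_equiv_self (deltaEquiv a),
    Matrix.submatrix_mul _ _ _ (nablaEquiv a) _ (nablaEquiv a).bijective, Matrix.det_mul,
    submatrix_M3_eq_rhombusMatrix]
  have h : (lowerMatrix a (-1) (-2)).submatrix (deltaEquiv a) (nablaEquiv a) =
      Matrix.of fun c c' => (tensorNorm a (deltaCell c).coords)⁻¹ *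
        (Matrix.of fun c c' => tensorNorm a (nablaCell c').coords *
          (rhombusMatrix a).transpose c c') c c' := by
    ext c c'
    simp only [Matrix.of_apply, Matrix.submatrix_apply, Matrix.transpose_apply,
      ← submatrix_M3_eq_rhombusMatrix]
    rw [nablaEquiv_apply, deltaEquiv_apply, ← lowerMatrix_apply,
      inv_mul_cancel_left₀ (tensorNorm_pos a _).ne']
  rw [h, Matrix.det_mul_column, Matrix.det_mul_row, Matrix.det_transpose, ← mul_assoc,
    ← Finset.prod_mul_distrib, mul_assoc, ← sq]
  congr 1
  refine Finset.prod_congr rfl fun c _ => ?_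
  rw [inv_mul_eq_iff_eq_mul₀ (tensorNorm_pos a _).ne', coords_nablaCell, coords_deltaCell]
  have := vectorNorm_add_one (a := a) (i := (c.1 : ℤ) - (c.2 : ℕ) - 1) (by omega) (by omega)
  rw [sub_add_cancel] at this
  simp only [tensorNorm, this]
  ring

theorem det_rhombusMatrix_sq (a : ℕ) :
    (∏ c : Fin a × Fin a, loweringCoeff a ((c.1 : ℤ) - (c.2 : ℕ))) *
        (rhombusMatrix a).det ^ 2 =
      ∏ m ∈ Finset.range (3 * a), ((m + 1 : ℚ) ^ 2) ^
        ((Fintype.card (TriangleOrbit (-2 - m) a) : ℤ) -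
          Fintype.card (TriangleOrbit (-3 - m) a)) := by
  have h := weightDet_neg_two_eq_prod a (3 * a)
  rw [weightDet_eq_one (s := -2 - (3 * a : ℕ)) (by push_cast; omega), mul_one] at h
  rw [← h, ← det_lowerMatrix_mul_raiseMatrix, weightDet_eq (s' := -1) (by norm_num), zero_smul,
    zero_add]

/-! ### Counting orbits -/

theorem rho_rho_ne_self_of_ne {s : ℤ} {a : ℕ} {t : Triangle s a} (h : rho s a t ≠ t) :
    rho s a (rho s a t) ≠ t := by
  intro h'
  exact h (by simpa only [rho_rho_rho] using (congrArg (rho s a) h').symm)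

theorem card_fiber_orbitOf {s : ℤ} {a : ℕ} {t : Triangle s a}
    (h : rho s a t ≠ t) : (Finset.univ.filter fun u => orbitOf u = orbitOf t).card = 3 := by
  classical
  have : (Finset.univ.filter fun u => orbitOf u = orbitOf t) =
      {t, rho s a t, rho s a (rho s a t)} := by
    ext u
    simp only [Finset.mem_filter, Finset.mem_univ, true_and, Finset.mem_insert,
      Finset.mem_singleton]
    rw [eq_comm, orbitOf_eq_iff]
  rw [this, Finset.card_eq_three]
  exact ⟨_, _, _, h.symm, (rho_rho_ne_self_of_ne h).symm,
    fun h' => h ((rho s a).injective h').symm, rfl⟩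

theorem card_fiber_orbitOf_of_fixed {s : ℤ} {a : ℕ} {t : Triangle s a}
    (h : rho s a t = t) : (Finset.univ.filter fun u => orbitOf u = orbitOf t).card = 1 := by
  rw [Finset.card_eq_one]
  refine ⟨t, ?_⟩
  ext u
  simp only [Finset.mem_filter, Finset.mem_univ, true_and, Finset.mem_singleton]
  rw [eq_comm, orbitOf_eq_iff, h, h, or_self, or_self]

theorem rho_eq_self_iff {s : ℤ} {a : ℕ} (t : Triangle s a) :
    rho s a t = t ↔ t.coords = (s / 3, s / 3, s / 3) := by
  have h := t.coords_inHexagon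
  simp only [InHexagon] at h
  rw [← Triangle.coords_injective.eq_iff, coords_rho]
  simp only [rotateCoords, Prod.ext_iff]
  omega

/-- Orbits have three elements, apart from that of a triangle with three equal coordinates. Such a
triangle exists precisely under the stated condition on `s`. -/
theorem card_triangle_add (s : ℤ) (a : ℕ) :
    (Fintype.card (Triangle s a) : ℤ) +
        2 * (if 3 ∣ s ∧ -(3 * a : ℤ) ≤ s ∧ s < 3 * a then 1 else 0) =
      3 * Fintype.card (TriangleOrbit s a) := by
  classical
  have h1 : (Fintype.card (Triangle s a) : ℤ) = ∑ r : TriangleOrbit s a,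
      ((Finset.univ.filter fun u : Triangle s a => orbitOf u = r).card : ℤ) := by
    rw [← Finset.card_univ,
      Finset.card_eq_sum_card_fiberwise (f := orbitOf) (t := Finset.univ) (by simp)]
    push_cast
    rfl
  have h3 : (3 : ℤ) * Fintype.card (TriangleOrbit s a) = ∑ r : TriangleOrbit s a, 3 := by
    rw [Finset.sum_const, Finset.card_univ, nsmul_eq_mul, mul_comm]
  rw [h1, h3]
  split_ifs with hs
  · have hw : InHexagon s a (s / 3, s / 3, s / 3) := by
      simp only [InHexagon]
      omega
    rw [show (2 : ℤ) * 1 = ∑ r : TriangleOrbit s a,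
      if r = orbitOf (Triangle.ofCoords _ hw) then 2 else 0 by simp, ← Finset.sum_add_distrib]
    refine Finset.sum_congr rfl fun r _ => ?_
    obtain ⟨t, rfl⟩ := exists_orbitOf_eq r
    by_cases ht : rho s a t = t
    · have e : t = Triangle.ofCoords _ hw :=
        Triangle.coords_injective ((rho_eq_self_iff t).1 ht)
      rw [card_fiber_orbitOf_of_fixed ht, if_pos (congrArg orbitOf e)]
      norm_num
    · rw [card_fiber_orbitOf ht, if_neg]
      · norm_num
      · intro h
        rw [eq_comm, orbitOf_eq_iff] at h
        have e := (rho_eq_self_iff _).2 (Triangle.coords_ofCoords _ hw)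
        rw [e, e, or_self, or_self] at h
        exact ht (h ▸ e)
  · rw [mul_zero, add_zero]
    refine Finset.sum_congr rfl fun r _ => ?_
    obtain ⟨t, rfl⟩ := exists_orbitOf_eq r
    rw [card_fiber_orbitOf]
    · norm_num
    · intro h
      have h' := t.coords_inHexagon
      rw [(rho_eq_self_iff t).1 h] at h'
      simp only [InHexagon] at h'
      omega

theorem card_triangle (s : ℤ) (a : ℕ) : (Fintype.card (Triangle s a) : ℤ) =
    ∑ k ∈ Finset.range (2 * a),
      ((min (a : ℤ) (s + a - k + a + 1) - max (-(a : ℤ)) (s + a - k - a + 1)).toNat : ℤ) := by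
  have h : Fintype.card (Triangle s a) = ((Finset.range (2 * a) ×ˢ Finset.Ico (-(a : ℤ)) a).filter
      fun x : ℕ × ℤ => -a ≤ s + a - x.1 - x.2 ∧ s + a - x.1 - x.2 < a).card := by
    rw [← Finset.card_univ]
    refine Finset.card_bij' (fun t _ => ((t.coords.1 + a).toNat, t.coords.2.1))
      (fun x hx => Triangle.ofCoords (x.1 - a, x.2, s + a - x.1 - x.2) ?_) ?_ ?_ ?_ ?_
    · simp only [Finset.mem_filter, Finset.mem_product, Finset.mem_range, Finset.mem_Ico] at hx
      simp only [InHexagon]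
      omega
    · intro t _
      have := t.coords_inHexagon
      simp only [InHexagon] at this
      simp only [Finset.mem_filter, Finset.mem_product, Finset.mem_range, Finset.mem_Ico]
      omega
    · intro x hx
      exact Finset.mem_univ _
    · intro t _
      have := t.coords_inHexagon
      simp only [InHexagon] at this
      apply Triangle.coords_injective
      rw [Triangle.coords_ofCoords]
      refine Prod.ext ?_ (Prod.ext ?_ ?_) <;> dsimp only <;> omega
    · intro x hx
      simp only [Triangle.coords_ofCoords]
      exact Prod.ext (by dsimp only; omega) rfl
  rw [h, Finset.card_filter, Finset.sum_product]
  push_cast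
  refine Finset.sum_congr rfl fun k _ => ?_
  rw [← Int.card_Ico, Finset.card_eq_sum_ones]
  push_cast
  rw [← Finset.sum_filter]
  refine Finset.sum_congr ?_ fun _ _ => rfl
  ext j
  simp only [Finset.mem_filter, Finset.mem_Ico]
  omega

/-- In `card_triangle` the summand depends only on `s - k`, so lowering `s` by one shifts the sum
and the difference telescopes to its end terms. -/
theorem card_triangle_sub (s : ℤ) (a : ℕ) :
    (Fintype.card (Triangle s a) : ℤ) - Fintype.card (Triangle (s - 1) a) =
      ((min (a : ℤ) (s + a + a + 1) - max (-(a : ℤ)) (s + a - a + 1)).toNat : ℤ) -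
      ((min (a : ℤ) (s - a + a + 1) - max (-(a : ℤ)) (s - a - a + 1)).toNat : ℤ) := by
  rw [card_triangle, card_triangle, ← Finset.sum_sub_distrib]
  have := Finset.sum_range_sub' (fun k : ℕ => (((min (a : ℤ) (s + a - k + a + 1) -
    max (-(a : ℤ)) (s + a - k - a + 1)).toNat : ℕ) : ℤ)) (2 * a)
  refine Eq.trans ?_ (this.trans ?_)
  · refine Finset.sum_congr rfl fun k _ => ?_
    push_cast
    omega
  · push_cast
    omega

/-- The dependence on `m` modulo 3 comes from the fixed triangle: it occurs in the first count when
`m % 3 = 1` and in the second when `m % 3 = 0`. The truncated term `a - 1 - m` vanishes from `m = a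
- 1` on. -/
theorem card_triangleOrbit_sub {a m : ℕ} (hm : m < 3 * a) :
    (Fintype.card (TriangleOrbit (-2 - m) a) : ℤ) - Fintype.card (TriangleOrbit (-3 - m) a) =
      ((if m % 3 = 1 then a - m / 3 else a - m / 3 - 1 : ℕ) : ℤ) - ((a - 1 - m : ℕ) : ℤ) := by
  have h1 := card_triangle_add (-2 - m) a
  have h2 := card_triangle_add (-3 - m) a
  have h3 := card_triangle_sub (-2 - m) a
  rw [show (-2 : ℤ) - m - 1 = -3 - m by ring] at h3
  split_ifs at h1 h2 ⊢ <;> omega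

/-! ### Products of factorials -/

theorem hyperfactorial_eq_prod_range (n : ℕ) :
    hyperfactorial n = ∏ j ∈ Finset.range n, j.factorial := by
  rw [hyperfactorial, stagHyperfactorial, Nat.div_one, Finset.range_eq_Ico]
  refine Finset.prod_bij' (fun j _ => n - j * 1) (fun j _ => n - j) ?_ ?_ ?_ ?_ ?_
  all_goals intro j hj; simp only [Finset.mem_Icc, Finset.mem_Ico] at *
  all_goals first | rfl | omega

theorem stagHyperfactorial_three (a : ℕ) :
    stagHyperfactorial 3 (3 * a + 2) = ∏ k ∈ Finset.range a, (3 * k + 2).factorial := by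
  rw [stagHyperfactorial, show (3 * a + 2) / 3 = a by omega, Finset.range_eq_Ico]
  refine Finset.prod_bij' (fun j _ => a - j) (fun j _ => a - j) ?_ ?_ ?_ ?_ ?_
  all_goals intro j hj; simp only [Finset.mem_Icc, Finset.mem_Ico] at *
  · omega
  · omega
  · omega
  · omega
  · congr 1
    omega

theorem stagFactorial_three (a : ℕ) :
    stagFactorial 3 (3 * (a : ℤ) - 2) = ∏ k ∈ Finset.range a, (3 * (k : ℤ) + 1) := by
  rw [stagFactorial]
  refine Finset.prod_bij' (fun j _ => a - 1 - j) (fun j _ => a - 1 - j) ?_ ?_ ?_ ?_ ?_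
  all_goals
    intro j hj
    simp only [Finset.mem_filter, Finset.mem_range] at *
  all_goals push_cast at *; omega

theorem prod_range_pow_sub (f : ℕ → ℚ) (a : ℕ) :
    ∏ m ∈ Finset.range a, f m ^ (a - 1 - m) =
      ∏ j ∈ Finset.range a, ∏ m ∈ Finset.range j, f m := by
  induction a with
  | zero => simp
  | succ a ih =>
    rw [Finset.prod_range_succ (fun j => ∏ m ∈ Finset.range j, f m), ← ih,
      Finset.prod_range_succ, Nat.add_sub_cancel, Nat.sub_self, pow_zero, mul_one,
      ← Finset.prod_mul_distrib]
    refine Finset.prod_congr rfl fun m hm => ?_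
    have := Finset.mem_range.1 hm
    rw [← pow_succ]
    congr 1
    omega

theorem prod_range_three_mul (f : ℕ → ℚ) (n : ℕ) :
    ∏ m ∈ Finset.range (3 * n), f m =
      ∏ k ∈ Finset.range n, f (3 * k) * f (3 * k + 1) * f (3 * k + 2) := by
  induction n with
  | zero => simp
  | succ n ih =>
    rw [Finset.prod_range_succ _ n, ← ih, show 3 * (n + 1) = 3 * n + 1 + 1 + 1 by ring,
      Finset.prod_range_succ, Finset.prod_range_succ, Finset.prod_range_succ]
    ring

theorem prod_range_add_one (n : ℕ) : ∏ m ∈ Finset.range n, (m + 1 : ℚ) = n.factorial := by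
  rw [← Finset.prod_range_add_one_eq_factorial]
  push_cast
  rfl

theorem prod_pow_eq_hyperfactorial (a : ℕ) :
    ∏ m ∈ Finset.range (3 * a), (m + 1 : ℚ) ^ (a - 1 - m) = hyperfactorial a := by
  rw [hyperfactorial_eq_prod_range, show 3 * a = a + 2 * a by ring, Finset.prod_range_add,
    Finset.prod_eq_one (s := Finset.range (2 * a)), mul_one,
    prod_range_pow_sub fun m => (m + 1 : ℚ)]
  · push_cast
    exact Finset.prod_congr rfl fun j _ => prod_range_add_one j
  · intro m _
    rw [show a - 1 - (a + m) = 0 by omega, pow_zero]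

/-- In the product of the `(3 * k + 2)!` the factors `3 * k + 1` and `3 * k + 2` occur `a - k` times
and `3 * k + 3` once less. The powers on the left lack exactly one factor `3 * k + 1` for each `k`,
and `stagFactorial` supplies it. -/
theorem prod_pow_mul_stagFactorial (a : ℕ) :
    (∏ m ∈ Finset.range (3 * a), (m + 1 : ℚ) ^ (if m % 3 = 1 then a - m / 3 else a - m / 3 - 1)) *
      (stagFactorial 3 (3 * (a : ℤ) - 2) : ℚ) = stagHyperfactorial 3 (3 * a + 2) := by
  have key : ∀ n : ℕ, ((3 * n + 2).factorial : ℚ) =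
      (∏ m ∈ Finset.range (3 * n), (m + 1 : ℚ)) * ((3 * n + 1) * (3 * n + 2)) := by
    intro n
    rw [prod_range_add_one, Nat.factorial_succ, Nat.factorial_succ]
    push_cast
    ring
  have h : ∀ n : ℕ, ∏ k ∈ Finset.range n, (((3 * k + 1) * (3 * k + 2) : ℚ) ^ (n - k) *
      (3 * k + 3 : ℚ) ^ (n - k - 1)) = ∏ k ∈ Finset.range n, ((3 * k + 2).factorial : ℚ) := by
    intro n
    induction n with
    | zero => simp
    | succ n ih =>
      rw [Finset.prod_range_succ _ n, Finset.prod_range_succ _ n, ← ih, key, prod_range_three_mul,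
        Nat.add_sub_cancel_left]
      conv_rhs => rw [← mul_assoc, ← Finset.prod_mul_distrib]
      simp only [pow_one, Nat.sub_self, pow_zero, mul_one]
      congr 1
      refine Finset.prod_congr rfl fun k hk => ?_
      have hk := Finset.mem_range.1 hk
      obtain ⟨d, rfl⟩ := Nat.exists_eq_add_of_lt hk
      rw [show k + d + 1 + 1 - k = d + 2 by omega, show k + d + 1 - k = d + 1 by omega]
      push_cast
      ring
  rw [stagFactorial_three, stagHyperfactorial_three, prod_range_three_mul]
  push_cast
  rw [← h, ← Finset.prod_mul_distrib]
  refine Finset.prod_congr rfl fun k hk => ?_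
  have hk := Finset.mem_range.1 hk
  rw [if_neg (by omega), if_pos (by omega), if_neg (by omega), show 3 * k / 3 = k by omega,
    show (3 * k + 1) / 3 = k by omega, show (3 * k + 2) / 3 = k by omega]
  obtain ⟨d, rfl⟩ := Nat.exists_eq_add_of_lt hk
  rw [show k + d + 1 - k = d + 1 by omega, Nat.add_sub_cancel, mul_pow]
  ring

/-- For fixed `p` the inner product is the falling factorial `(a + p)! / p!`. -/
theorem prod_rhombus (a : ℕ) : (∏ c : Fin a × Fin a, ((a : ℚ) + (c.1 : ℕ) - (c.2 : ℕ))) *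
    (hyperfactorial a : ℚ) ^ 2 = hyperfactorial (2 * a) := by
  have h : ∀ p : ℕ, (∏ q ∈ Finset.range a, ((a : ℚ) + p - q)) * p.factorial =
      (a + p).factorial := by
    intro p
    have := Nat.factorial_mul_descFactorial (Nat.le_add_right a p)
    rw [Nat.add_sub_cancel_left, Nat.descFactorial_eq_prod_range] at this
    rw [← this, mul_comm]
    push_cast
    congr 1
    refine Finset.prod_congr rfl fun q hq => ?_
    have := Finset.mem_range.1 hq
    rw [Nat.cast_sub (by omega)]
    push_cast
    ring
  rw [Fintype.prod_prod_type, Finset.prod_congr rfl fun (p : Fin a) _ =>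
    Fin.prod_univ_eq_prod_range (fun q : ℕ => (a : ℚ) + (p : ℕ) - q) a,
    Fin.prod_univ_eq_prod_range (fun p : ℕ => ∏ q ∈ Finset.range a, ((a : ℚ) + p - q)) a]
  simp only [hyperfactorial_eq_prod_range]
  rw [two_mul, Finset.prod_range_add]
  push_cast
  rw [sq, ← mul_assoc, ← Finset.prod_mul_distrib, Finset.prod_congr rfl fun p _ => h p, mul_comm]

/-- The reflection of the rhombus exchanging `p` and `q` interchanges the two factors of
`loweringCoeff`, so the product is a perfect square and a square root can later be taken. -/
theorem prod_loweringCoeff (a : ℕ) :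
    ∏ c : Fin a × Fin a, loweringCoeff a ((c.1 : ℤ) - (c.2 : ℕ)) =
      (∏ c : Fin a × Fin a, ((a : ℚ) + (c.1 : ℕ) - (c.2 : ℕ))) ^ 2 := by
  have h : ∏ c : Fin a × Fin a, ((a : ℚ) - (c.1 : ℕ) + (c.2 : ℕ)) =
      ∏ c : Fin a × Fin a, ((a : ℚ) + (c.1 : ℕ) - (c.2 : ℕ)) := by
    rw [← Equiv.prod_comp (Equiv.prodComm (Fin a) (Fin a))]
    refine Finset.prod_congr rfl fun c _ => ?_
    simp only [Equiv.prodComm_apply, Prod.fst_swap, Prod.snd_swap]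
    ring
  rw [sq]
  nth_rw 2 [← h]
  rw [← Finset.prod_mul_distrib]
  refine Finset.prod_congr rfl fun c _ => ?_
  rw [loweringCoeff]
  push_cast
  ring

theorem hyperfactorial_pos (n : ℕ) : 0 < hyperfactorial n := by
  rw [hyperfactorial_eq_prod_range]
  exact Finset.prod_pos fun j _ => j.factorial_pos

theorem stagFactorial_three_pos (a : ℕ) : 0 < stagFactorial 3 (3 * (a : ℤ) - 2) := by
  rw [stagFactorial_three]
  exact Finset.prod_pos fun k _ => by positivity

theorem abs_det_rhombusMatrix (a : ℕ) : |(rhombusMatrix a).det| =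
    ((stagHyperfactorial 3 (3 * a + 2) : ℚ) * (hyperfactorial a : ℚ)) /
      ((hyperfactorial (2 * a) : ℚ) * (stagFactorial 3 (3 * (a : ℤ) - 2) : ℚ)) := by
  have hH := hyperfactorial_pos a
  have hH2 := hyperfactorial_pos (2 * a)
  have hF := stagFactorial_three_pos a
  have hHq : (0 : ℚ) < hyperfactorial a := by exact_mod_cast hH
  have hH2q : (0 : ℚ) < hyperfactorial (2 * a) := by exact_mod_cast hH2
  have hFq : (0 : ℚ) < stagFactorial 3 (3 * (a : ℤ) - 2) := by exact_mod_cast hF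
  have hS := prod_rhombus a
  have hSpos : 0 < ∏ c : Fin a × Fin a, ((a : ℚ) + (c.1 : ℕ) - (c.2 : ℕ)) := by
    refine pos_of_mul_pos_left (b := (hyperfactorial a : ℚ) ^ 2) ?_ (by positivity)
    rw [hS]
    exact hH2q
  set S := ∏ c : Fin a × Fin a, ((a : ℚ) + (c.1 : ℕ) - (c.2 : ℕ)) with hSdef
  set P := ∏ m ∈ Finset.range (3 * a), (m + 1 : ℚ) ^
    ((Fintype.card (TriangleOrbit (-2 - m) a) : ℤ) - Fintype.card (TriangleOrbit (-3 - m) a))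
    with hPdef
  have hPpos : 0 < P := Finset.prod_pos fun m _ => zpow_pos (by positivity) _
  have hPS : S * |(rhombusMatrix a).det| = P := by
    have h := det_rhombusMatrix_sq a
    rw [prod_loweringCoeff, ← hSdef] at h
    have hP2 : P ^ 2 = ∏ m ∈ Finset.range (3 * a), ((m + 1 : ℚ) ^ 2) ^
        ((Fintype.card (TriangleOrbit (-2 - m) a) : ℤ) -
          Fintype.card (TriangleOrbit (-3 - m) a)) := by
      rw [hPdef, ← Finset.prod_pow]
      refine Finset.prod_congr rfl fun m _ => ?_
      rw [← zpow_natCast, ← zpow_natCast, ← zpow_mul, ← zpow_mul, mul_comm]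
    rw [← hP2, ← sq_abs (rhombusMatrix a).det, ← mul_pow] at h
    -- Every factor in the identity is a square; positivity of `S` and `P` selects the roots.
    exact (sq_eq_sq₀ (by positivity) hPpos.le).1 h
  -- Multiplying by `H(a)` removes the subtracted part `a - 1 - m` of the exponents.
  have hPH : P * hyperfactorial a = ∏ m ∈ Finset.range (3 * a),
      (m + 1 : ℚ) ^ (if m % 3 = 1 then a - m / 3 else a - m / 3 - 1) := by
    rw [hPdef, ← prod_pow_eq_hyperfactorial, ← Finset.prod_mul_distrib]
    refine Finset.prod_congr rfl fun m hm => ?_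
    have h0 : (m + 1 : ℚ) ≠ 0 := by positivity
    rw [card_triangleOrbit_sub (Finset.mem_range.1 hm), ← zpow_natCast, ← zpow_add₀ h0,
      sub_add_cancel, zpow_natCast]
  have hfin := prod_pow_mul_stagFactorial a
  rw [← hPH] at hfin
  rw [eq_div_iff (by positivity), ← hfin, ← hS, ← hPS]
  ring

/-! ### Height functions and cyclically symmetric plane partitions -/

/-- The height functions of the shells of cyclically symmetric plane partitions: `h p q` is the
number of cubes of the form `(p + m, q + m, m)`. -/
structure IsHeight (a : ℕ) (h : ℕ → ℕ → ℕ) : Prop where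
  anti_left : ∀ p q, h (p + 1) q ≤ h p q
  anti_right : ∀ p q, h p (q + 1) ≤ h p q
  diag : ∀ p q, h p q ≤ h (p + 1) (q + 1) + 1
  zero_left : ∀ p q, a ≤ p → h p q = 0
  zero_right : ∀ p q, a ≤ q → h p q = 0
  symm : ∀ p, h p 0 = h 0 p

theorem IsHeight.anti {a : ℕ} {h : ℕ → ℕ → ℕ} (hh : IsHeight a h) {p p' q q' : ℕ} (hp : p ≤ p')
    (hq : q ≤ q') : h p' q' ≤ h p q :=
  (antitone_nat_of_succ_le (f := fun p => h p q') (fun p => hh.anti_left p q') hp).trans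
    (antitone_nat_of_succ_le (f := fun q => h p q) (fun q => hh.anti_right p q) hq)

theorem IsHeight.le_add {a : ℕ} {h : ℕ → ℕ → ℕ} (hh : IsHeight a h) (p q e : ℕ) :
    h p q ≤ h (p + e) (q + e) + e := by
  induction e with
  | zero => rfl
  | succ e ih =>
    have := hh.diag (p + e) (q + e)
    simp only [← add_assoc]
    omega

/-- The cube `(x, y, z)` lies in the plane partition with height function `h`, its last coordinate
being the least one. -/
def HeightMemLast (h : ℕ → ℕ → ℕ) (x y z : ℕ) : Prop :=
  z ≤ x ∧ z ≤ y ∧ z < h (x - z) (y - z)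

/-- The cube `(x, y, z)` lies in the plane partition with height function `h`. -/
def HeightMem (h : ℕ → ℕ → ℕ) (x y z : ℕ) : Prop :=
  HeightMemLast h x y z ∨ HeightMemLast h y z x ∨ HeightMemLast h z x y

theorem heightMem_rotate (h : ℕ → ℕ → ℕ) (x y z : ℕ) :
    HeightMem h y z x ↔ HeightMem h x y z := by
  unfold HeightMem
  tauto

/-- The cases record which coordinate of the smaller cube is least. Going down a diagonal costs at
most one unit of height per step; when the least coordinate changes, the boundary symmetry `hh.symm`
passes from one side of the rhombus to the other. -/
theorem IsHeight.heightMem_of_le_of_last {a : ℕ} {h : ℕ → ℕ → ℕ} (hh : IsHeight a h)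
    {x y z x' y' z' : ℕ} (hx : x' ≤ x) (hy : y' ≤ y) (hz : z' ≤ z) (hm : HeightMemLast h x y z) :
    HeightMem h x' y' z' := by
  obtain ⟨h1, h2, h3⟩ := hm
  by_cases hz' : z' ≤ x' ∧ z' ≤ y'
  · refine Or.inl ⟨hz'.1, hz'.2, ?_⟩
    have e1 := hh.anti (show x' - z' ≤ x - z + (z - z') by omega)
      (show y' - z' ≤ y - z + (z - z') by omega)
    have e2 := hh.le_add (x - z) (y - z) (z - z')
    omega
  by_cases hx' : x' ≤ y' ∧ x' ≤ z'
  · refine Or.inr (Or.inl ⟨hx'.1, hx'.2, ?_⟩)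
    have e1 := hh.anti (show y' - x' ≤ y - z + (z - x') by omega)
      (show z' - x' ≤ 0 + (z - x') by omega)
    have e2 := hh.le_add (y - z) 0 (z - x')
    have e3 := hh.symm (y - z)
    have e4 := hh.anti (Nat.zero_le (x - z)) (le_refl (y - z))
    omega
  · refine Or.inr (Or.inr ⟨by omega, by omega, ?_⟩)
    have e1 := hh.anti (show z' - y' ≤ 0 + (z - y') by omega)
      (show x' - y' ≤ x - z + (z - y') by omega)
    have e2 := hh.le_add 0 (x - z) (z - y')
    have e3 := hh.symm (x - z)
    have e4 := hh.anti (le_refl (x - z)) (Nat.zero_le (y - z))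
    omega

theorem IsHeight.heightMem_of_le {a : ℕ} {h : ℕ → ℕ → ℕ} (hh : IsHeight a h)
    {x y z x' y' z' : ℕ} (hx : x' ≤ x) (hy : y' ≤ y) (hz : z' ≤ z) (hm : HeightMem h x y z) :
    HeightMem h x' y' z' := by
  rcases hm with hm | hm | hm
  · exact hh.heightMem_of_le_of_last hx hy hz hm
  · rw [← heightMem_rotate]
    exact hh.heightMem_of_le_of_last hy hz hx hm
  · rw [← heightMem_rotate, ← heightMem_rotate]
    exact hh.heightMem_of_le_of_last hz hx hy hm

/-- A second rotation of the cube can have its least coordinate last only in case of a tie. Then `p`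
or `q` is zero, and the boundary symmetry makes the two conditions agree. -/
theorem IsHeight.heightMem_iff {a : ℕ} {h : ℕ → ℕ → ℕ} (hh : IsHeight a h) (p q m : ℕ) :
    HeightMem h (p + m) (q + m) m ↔ m < h p q := by
  constructor
  · rintro (⟨h1, h2, h3⟩ | ⟨h1, h2, h3⟩ | ⟨h1, h2, h3⟩)
    · simpa using h3
    · obtain rfl : p = 0 := by omega
      rw [← hh.symm]
      simpa using h3
    · obtain rfl : q = 0 := by omega
      rw [hh.symm]
      simpa using h3
  · intro h1
    exact Or.inl ⟨by omega, by omega, by simpa using h1⟩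

theorem IsHeight.lt_of_heightMemLast {a : ℕ} {h : ℕ → ℕ → ℕ} (hh : IsHeight a h) {x y z : ℕ}
    (hm : HeightMemLast h x y z) : x < a ∧ y < a ∧ z < a := by
  obtain ⟨h1, h2, h3⟩ := hm
  have e1 := hh.le_add (x - z) (y - z) (a - (x - z))
  have e2 := hh.le_add (x - z) (y - z) (a - (y - z))
  have e3 := hh.zero_left (x - z + (a - (x - z))) (y - z + (a - (x - z))) (by omega)
  have e4 := hh.zero_right (x - z + (a - (y - z))) (y - z + (a - (y - z))) (by omega)
  omega

theorem IsHeight.lt_of_heightMem {a : ℕ} {h : ℕ → ℕ → ℕ} (hh : IsHeight a h) {x y z : ℕ}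
    (hm : HeightMem h x y z) : x < a ∧ y < a ∧ z < a := by
  rcases hm with hm | hm | hm
  all_goals
    have := hh.lt_of_heightMemLast hm
    tauto

theorem mem_box {a x y z : ℕ} : (x, y, z) ∈ box a a a ↔ x < a ∧ y < a ∧ z < a := by
  simp [box]

open Classical in
/-- The plane partition with a given height function. -/
noncomputable def heightPartition (a : ℕ) (h : ℕ → ℕ → ℕ) : Finset (ℕ × ℕ × ℕ) :=
  (box a a a).filter fun c => HeightMem h c.1 c.2.1 c.2.2

theorem IsHeight.mem_heightPartition {a : ℕ} {h : ℕ → ℕ → ℕ} (hh : IsHeight a h) (x y z : ℕ) :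
    (x, y, z) ∈ heightPartition a h ↔ HeightMem h x y z := by
  classical
  rw [heightPartition, Finset.mem_filter, mem_box, and_iff_right_iff_imp]
  exact hh.lt_of_heightMem

theorem IsHeight.heightPartition_mem {a : ℕ} {h : ℕ → ℕ → ℕ} (hh : IsHeight a h) :
    heightPartition a h ∈ cyclicallySymmetricPlanePartitions a := by
  classical
  refine ⟨?_, Finset.filter_subset _ _, ?_⟩
  · rintro ⟨x, y, z⟩ ⟨x', y', z'⟩ ⟨h1, h2, h3⟩ hm
    rw [Finset.mem_coe, hh.mem_heightPartition] at hm ⊢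
    exact hh.heightMem_of_le h1 h2 h3 hm
  · ext ⟨x, y, z⟩
    rw [mem_rotatePartition, hh.mem_heightPartition, hh.mem_heightPartition, heightMem_rotate]

/-- The height function of a plane partition. -/
def partitionHeight (a : ℕ) (π : Finset (ℕ × ℕ × ℕ)) (p q : ℕ) : ℕ :=
  ((Finset.range a).filter fun m => (p + m, q + m, m) ∈ π).card

/-- A downward closed bounded set of naturals is an initial segment, so its cardinality is the first
place where `P` fails. -/
theorem lt_card_filter_iff {a : ℕ} {P : ℕ → Prop} [DecidablePred P]
    (hP : ∀ m n, m ≤ n → P n → P m) (ha : ∀ m, P m → m < a) (m : ℕ) :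
    m < ((Finset.range a).filter P).card ↔ P m := by
  have hex : ∃ n, ¬ P n := ⟨a, fun h => lt_irrefl _ (ha _ h)⟩
  have key : ∀ m, P m ↔ m < Nat.find hex := by
    intro m
    rw [Nat.lt_find_iff]
    simp only [not_not]
    exact ⟨fun h k hk => hP k m hk h, fun h => h m le_rfl⟩
  have : (Finset.range a).filter P = Finset.range (Nat.find hex) := by
    ext k
    rw [Finset.mem_filter, Finset.mem_range, Finset.mem_range, ← key,
      and_iff_right_iff_imp]
    exact ha k
  rw [this, Finset.card_range, key]

theorem lt_partitionHeight_iff {a : ℕ} {π : Finset (ℕ × ℕ × ℕ)}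
    (hπ : π ∈ cyclicallySymmetricPlanePartitions a) (p q m : ℕ) :
    m < partitionHeight a π p q ↔ (p + m, q + m, m) ∈ π := by
  refine lt_card_filter_iff (P := fun m => (p + m, q + m, m) ∈ π) (fun m n hmn hn => ?_)
    (fun m hm => (mem_box.1 (hπ.2.1 hm)).2.2) m
  exact hπ.1 (show (p + m, q + m, m) ≤ (p + n, q + n, n) from
    ⟨Nat.add_le_add_left hmn p, Nat.add_le_add_left hmn q, hmn⟩) hn

theorem mem_rotate_iff {a : ℕ} {π : Finset (ℕ × ℕ × ℕ)}
    (hπ : π ∈ cyclicallySymmetricPlanePartitions a) (x y z : ℕ) :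
    (y, z, x) ∈ π ↔ (x, y, z) ∈ π := by
  rw [← mem_rotatePartition, hπ.2.2]

theorem isHeight_partitionHeight {a : ℕ} {π : Finset (ℕ × ℕ × ℕ)}
    (hπ : π ∈ cyclicallySymmetricPlanePartitions a) : IsHeight a (partitionHeight a π) where
  anti_left p q := by
    refine le_of_forall_lt fun m hm => ?_
    rw [lt_partitionHeight_iff hπ] at hm ⊢
    exact hπ.1 (show (p + m, q + m, m) ≤ (p + 1 + m, q + m, m) from
      ⟨by dsimp only; omega, le_rfl, le_rfl⟩) hm
  anti_right p q := by
    refine le_of_forall_lt fun m hm => ?_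
    rw [lt_partitionHeight_iff hπ] at hm ⊢
    exact hπ.1 (show (p + m, q + m, m) ≤ (p + m, q + 1 + m, m) from
      ⟨le_rfl, by dsimp only; omega, le_rfl⟩) hm
  diag p q := by
    by_contra! hlt
    rw [lt_partitionHeight_iff hπ] at hlt
    refine lt_irrefl (partitionHeight a π (p + 1) (q + 1)) ?_
    rw [lt_partitionHeight_iff hπ]
    refine hπ.1 ?_ hlt
    exact ⟨by dsimp only; omega, by dsimp only; omega, by dsimp only; omega⟩
  zero_left p q hp := by
    by_contra h
    have := mem_box.1 (hπ.2.1 ((lt_partitionHeight_iff hπ p q 0).1 (Nat.pos_of_ne_zero h)))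
    omega
  zero_right p q hp := by
    by_contra h
    have := mem_box.1 (hπ.2.1 ((lt_partitionHeight_iff hπ p q 0).1 (Nat.pos_of_ne_zero h)))
    omega
  symm p := by
    refine eq_of_forall_lt_iff fun m => ?_
    rw [lt_partitionHeight_iff hπ, lt_partitionHeight_iff hπ, mem_rotate_iff hπ, zero_add]

theorem N3_eq_ncard_isHeight (a : ℕ) : N3 a = {h | IsHeight a h}.ncard := by
  refine Set.ncard_congr (fun π _ => partitionHeight a π)
    (fun π hπ => isHeight_partitionHeight hπ) ?_ ?_
  · intro π π' hπ hπ' heq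
    have hlast : ∀ x y z, z ≤ x → z ≤ y → ((x, y, z) ∈ π ↔ (x, y, z) ∈ π') := by
      intro x y z hx hy
      have h1 := lt_partitionHeight_iff hπ (x - z) (y - z) z
      have h2 := lt_partitionHeight_iff hπ' (x - z) (y - z) z
      rw [Nat.sub_add_cancel hx, Nat.sub_add_cancel hy] at h1 h2
      rw [← h1, ← h2, heq]
    ext ⟨x, y, z⟩
    by_cases hz : z ≤ x ∧ z ≤ y
    · exact hlast x y z hz.1 hz.2
    by_cases hx : x ≤ y ∧ x ≤ z
    · rw [← mem_rotate_iff hπ, ← mem_rotate_iff hπ']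
      exact hlast y z x hx.1 hx.2
    · rw [← mem_rotate_iff hπ, ← mem_rotate_iff hπ', ← mem_rotate_iff hπ, ← mem_rotate_iff hπ']
      exact hlast z x y (by omega) (by omega)
  · intro h hh
    refine ⟨heightPartition a h, hh.heightPartition_mem, ?_⟩
    ext p q
    refine eq_of_forall_lt_iff fun m => ?_
    rw [lt_partitionHeight_iff hh.heightPartition_mem, hh.mem_heightPartition, hh.heightMem_iff]

/-! ### Height functions and fields of moves -/

/-- The moves of the lozenges of the fundamental rhombus which describe a perfect matching of `Z₃`:
the `Δ` triangle of a lozenge is matched with the `∇` triangle of the same lozenge (`0`), of its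
left neighbour, cyclically across the centre of the hexagon (`1`), or of its upper neighbour (`2`).
The value is `3` outside the rhombus. -/
structure IsMoveField (a : ℕ) (F : ℕ → ℕ → ℕ) : Prop where
  le_two : ∀ p q, p < a → q < a → F p q ≤ 2
  out : ∀ p q, a ≤ p ∨ a ≤ q → F p q = 3
  top : ∀ p q, q + 1 = a → F p q ≠ 2
  incoming : ∀ p q, p < a → q < a →
    (if F p q = 0 then 1 else 0) + (if F (p + 1) q = 1 then 1 else 0) +
      (if q = 0 then (if F 0 p = 1 then 1 else 0) else (if F p (q - 1) = 2 then 1 else 0)) = 1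

/-- The height function of a field of moves. -/
def moveHeight (a : ℕ) (F : ℕ → ℕ → ℕ) (p q : ℕ) : ℕ :=
  ∑ k ∈ Finset.Ico q a, if F p k = 1 then 1 else 0

theorem moveHeight_of_le {a : ℕ} (F : ℕ → ℕ → ℕ) (p : ℕ) {q : ℕ} (h : a ≤ q) :
    moveHeight a F p q = 0 := by
  rw [moveHeight, Finset.Ico_eq_empty_of_le h, Finset.sum_empty]

theorem IsMoveField.moveHeight_left {a : ℕ} {F : ℕ → ℕ → ℕ} (hF : IsMoveField a F) {p : ℕ}
    (h : a ≤ p) (q : ℕ) : moveHeight a F p q = 0 := by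
  refine Finset.sum_eq_zero fun k _ => ?_
  rw [hF.out p k (Or.inl h)]
  rfl

theorem IsMoveField.moveHeight_eq_right {a : ℕ} {F : ℕ → ℕ → ℕ} (hF : IsMoveField a F) (p q : ℕ) :
    moveHeight a F p q = moveHeight a F p (q + 1) + if F p q = 1 then 1 else 0 := by
  rcases lt_or_ge q a with h | h
  · rw [moveHeight, Finset.sum_eq_sum_Ico_succ_bot h, add_comm]
    rfl
  · rw [moveHeight_of_le F p h, moveHeight_of_le F p (by omega), hF.out p q (Or.inr h)]
    rfl

/-- Conservation of flow: the excess of column `p` over column `p + 1` is what enters column `p` at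
`q` from below, or across the centre when `q = 0`. The induction descends from the top, where
nothing passes, using that each cell has one incoming and one outgoing move. -/
theorem IsMoveField.moveHeight_eq_left {a : ℕ} {F : ℕ → ℕ → ℕ} (hF : IsMoveField a F) {p : ℕ}
    (hp : p < a) {q : ℕ} (hq : q ≤ a) : moveHeight a F p q = moveHeight a F (p + 1) q +
      if q = 0 then (if F 0 p = 1 then 1 else 0) else (if F p (q - 1) = 2 then 1 else 0) := by
  induction hq using Nat.decreasingInduction with
  | self =>
    rw [moveHeight_of_le F p le_rfl, moveHeight_of_le F _ le_rfl, if_neg (by omega), if_neg]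
    exact hF.top p (a - 1) (by omega)
  | of_succ q hq ih =>
    have h1 := hF.moveHeight_eq_right p q
    have h2 := hF.moveHeight_eq_right (p + 1) q
    have h3 := hF.incoming p q hp hq
    have h4 := hF.le_two p q hp hq
    rw [if_neg (Nat.succ_ne_zero q), Nat.add_sub_cancel] at ih
    split_ifs at * <;> omega

theorem IsMoveField.isHeight {a : ℕ} {F : ℕ → ℕ → ℕ} (hF : IsMoveField a F) :
    IsHeight a (moveHeight a F) where
  anti_left p q := by
    by_cases h : p < a ∧ q ≤ a
    · rw [hF.moveHeight_eq_left h.1 h.2]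
      exact Nat.le_add_right _ _
    · by_cases h' : p < a
      · rw [moveHeight_of_le F _ (by omega), moveHeight_of_le F _ (by omega)]
      · rw [hF.moveHeight_left (by omega), hF.moveHeight_left (by omega)]
  anti_right p q := by
    rw [hF.moveHeight_eq_right p q]
    exact Nat.le_add_right _ _
  diag p q := by
    by_cases h : p < a ∧ q < a
    · have h1 := hF.moveHeight_eq_right p q
      have h2 := hF.moveHeight_eq_left h.1 (q := q + 1) (by omega)
      rw [if_neg (Nat.succ_ne_zero q), Nat.add_sub_cancel] at h2
      split_ifs at h1 h2 <;> omega
    · by_cases h' : p < a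
      · rw [moveHeight_of_le F _ (by omega)]
        exact Nat.zero_le _
      · rw [hF.moveHeight_left (by omega)]
        exact Nat.zero_le _
  zero_left p q h := hF.moveHeight_left h q
  zero_right p q h := moveHeight_of_le F p h
  symm p := by
    rcases le_total a p with h | h
    · rw [hF.moveHeight_left h, moveHeight_of_le F _ h]
    · induction h using Nat.decreasingInduction with
      | self => rw [hF.moveHeight_left le_rfl, moveHeight_of_le F _ le_rfl]
      | of_succ p hp ih =>
        -- Both sides of the symmetry change by the same amount, the crossing of the centre at `(0,
        -- p)`.
        rw [hF.moveHeight_eq_left hp (Nat.zero_le _), hF.moveHeight_eq_right 0 p, ih, if_pos rfl]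

/-- The field of moves of a height function. -/
def heightMove (a : ℕ) (h : ℕ → ℕ → ℕ) (p q : ℕ) : ℕ :=
  if a ≤ p ∨ a ≤ q then 3 else if h p q = h (p + 1) (q + 1) then 0
  else if h p q = h p (q + 1) then 2 else 1

theorem heightMove_eq_zero_iff {a : ℕ} {h : ℕ → ℕ → ℕ} {p q : ℕ} (hp : p < a) (hq : q < a) :
    heightMove a h p q = 0 ↔ h p q = h (p + 1) (q + 1) := by
  unfold heightMove
  split_ifs <;> simp <;> omega

theorem IsHeight.heightMove_eq_one_iff {a : ℕ} {h : ℕ → ℕ → ℕ} (hh : IsHeight a h) (p q : ℕ) :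
    heightMove a h p q = 1 ↔ h p q ≠ h p (q + 1) := by
  have h1 := hh.anti_right p q
  have h2 := hh.anti_left p (q + 1)
  have h3 := hh.zero_left p q
  have h4 := hh.zero_right p q
  unfold heightMove
  split_ifs <;> simp <;> omega

theorem IsHeight.heightMove_eq_two_iff {a : ℕ} {h : ℕ → ℕ → ℕ} (hh : IsHeight a h) (p q : ℕ) :
    heightMove a h p q = 2 ↔ h p (q + 1) ≠ h (p + 1) (q + 1) := by
  have h1 := hh.anti_right p q
  have h2 := hh.anti_left p (q + 1)
  have h3 := hh.zero_left p (q + 1)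
  have h4 := hh.zero_right p (q + 1)
  have h5 := hh.diag p q
  unfold heightMove
  split_ifs <;> simp <;> omega

theorem IsHeight.isMoveField {a : ℕ} {h : ℕ → ℕ → ℕ} (hh : IsHeight a h) :
    IsMoveField a (heightMove a h) where
  le_two p q hp hq := by
    unfold heightMove
    split_ifs <;> omega
  out p q hpq := by
    unfold heightMove
    rw [if_pos hpq]
  top p q hq := by
    rw [Ne, hh.heightMove_eq_two_iff, hh.zero_right p (q + 1) (by omega),
      hh.zero_right (p + 1) (q + 1) (by omega)]
    simp
  incoming p q hp hq := by
    simp only [heightMove_eq_zero_iff hp hq, hh.heightMove_eq_one_iff, hh.heightMove_eq_two_iff]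
    have h1 := hh.anti_left p q
    have h2 := hh.anti_right (p + 1) q
    have h3 := hh.diag p q
    rcases Nat.eq_zero_or_pos q with rfl | hq0
    · have h4 := hh.symm p
      have h5 := hh.symm (p + 1)
      rw [if_pos rfl]
      split_ifs <;> omega
    · rw [if_neg hq0.ne', Nat.sub_add_cancel hq0]
      split_ifs <;> omega

/-- On the path from `(p, q)` to `(p, q + 1)` to `(p + 1, q + 1)` the height drops by at most one in
all. A drop in the first step is move 1, a drop in the second is move 2, and no drop is move 0, so
heights and moves determine each other. -/
theorem ncard_isMoveField (a : ℕ) : {F | IsMoveField a F}.ncard = {h | IsHeight a h}.ncard := by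
  refine Set.ncard_congr (fun F _ => moveHeight a F) (fun F hF => hF.isHeight) ?_ ?_
  · intro F F' (hF : IsMoveField a F) (hF' : IsMoveField a F') heq
    have e : ∀ p q, moveHeight a F p q = moveHeight a F' p q := fun p q =>
      congrFun (congrFun heq p) q
    ext p q
    by_cases hpq : p < a ∧ q < a
    · have h1 := hF.moveHeight_eq_right p q
      have h2 := hF'.moveHeight_eq_right p q
      have h3 := hF.moveHeight_eq_left hpq.1 (q := q + 1) hpq.2
      have h4 := hF'.moveHeight_eq_left hpq.1 (q := q + 1) hpq.2
      rw [if_neg (Nat.succ_ne_zero q), Nat.add_sub_cancel, e, e] at h3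
      rw [if_neg (Nat.succ_ne_zero q), Nat.add_sub_cancel] at h4
      rw [e, e] at h1
      have h5 := hF.le_two p q hpq.1 hpq.2
      have h6 := hF'.le_two p q hpq.1 hpq.2
      split_ifs at h1 h2 h3 h4 <;> omega
    · rw [hF.out p q (by omega), hF'.out p q (by omega)]
  · intro h (hh : IsHeight a h)
    refine ⟨heightMove a h, hh.isMoveField, ?_⟩
    ext p q
    rcases le_total a q with hq | hq
    · rw [moveHeight_of_le _ _ hq, hh.zero_right _ _ hq]
    · induction hq using Nat.decreasingInduction with
      | self => rw [moveHeight_of_le _ _ le_rfl, hh.zero_right _ _ le_rfl]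
      | of_succ q hq ih =>
        rw [hh.isMoveField.moveHeight_eq_right, ih]
        have h1 := hh.heightMove_eq_one_iff p q
        have h2 := hh.anti_right p q
        have h3 := hh.diag p q
        have h4 := hh.anti_left p (q + 1)
        split_ifs <;> omega

/-! ### The determinant of the rhombus matrix counts fields of moves -/

/-- The move `d` takes the lozenge `(p, q)` to the lozenge `(p', q')`. -/
def IsMove (d p q p' q' : ℕ) : Prop :=
  (d = 0 ∧ p' = p ∧ q' = q) ∨ (d = 1 ∧ p = 0 ∧ p' = q ∧ q' = 0) ∨ (d = 1 ∧ p' + 1 = p ∧ q' = q) ∨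
    (d = 2 ∧ p' = p ∧ q' = q + 1)

theorem IsMove.unique {d p q p' q' p'' q'' : ℕ} (h : IsMove d p q p' q')
    (h' : IsMove d p q p'' q'') : p' = p'' ∧ q' = q'' := by
  unfold IsMove at h h'
  omega

open Classical in
theorem rhombusEntry_eq_sum (p' q' p q : ℕ) :
    rhombusEntry p' q' p q = ∑ d : Fin 3, if IsMove d p q p' q' then 1 else 0 := by
  rw [Fin.sum_univ_three, rhombusEntry]
  congr 1
  · congr 1
    · refine if_congr ?_ rfl rfl
      simp [IsMove]
    · refine if_congr ?_ rfl rfl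
      simp [IsMove]
  · refine if_congr ?_ rfl rfl
    simp [IsMove]

/-- The pairs of a permutation of the lozenges and a choice of moves which induces it. -/
def movePairs (a : ℕ) : Set (Equiv.Perm (Fin a × Fin a) × (Fin a × Fin a → Fin 3)) :=
  {x | ∀ c, IsMove (x.2 c) c.1 c.2 (x.1 c).1 (x.1 c).2}

-- The choice of moves is kept beside the permutation because of multiple edges: at the cell `(0,
-- 0)` the moves 0 and 1 both stay in place, and the matrix entry is 2.
open Classical in
theorem det_rhombusMatrix_eq_sum (a : ℕ) : (rhombusMatrix a).det =
    ∑ x : Equiv.Perm (Fin a × Fin a) × (Fin a × Fin a → Fin 3),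
      if x ∈ movePairs a then ((Equiv.Perm.sign x.1 : ℤ) : ℚ) else 0 := by
  rw [Matrix.det_apply', Fintype.sum_prod_type]
  refine Finset.sum_congr rfl fun σ _ => ?_
  simp only [rhombusMatrix, Matrix.of_apply, rhombusEntry_eq_sum]
  rw [Finset.prod_univ_sum, Fintype.piFinset_univ, Finset.mul_sum]
  refine Finset.sum_congr rfl fun f _ => ?_
  by_cases h : (σ, f) ∈ movePairs a
  · rw [if_pos h, Finset.prod_eq_one fun c _ => if_pos (h c), mul_one]
  · rw [if_neg h]
    obtain ⟨c, hc⟩ := not_forall.1 h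
    rw [Finset.prod_eq_zero (Finset.mem_univ c) (if_neg hc), mul_zero]

/-- The field of moves given by a choice of moves. -/
def moveField {a : ℕ} (f : Fin a × Fin a → Fin 3) (p q : ℕ) : ℕ :=
  if h : p < a ∧ q < a then (f (⟨p, h.1⟩, ⟨q, h.2⟩) : ℕ) else 3

theorem moveField_coe {a : ℕ} (f : Fin a × Fin a → Fin 3) (c : Fin a × Fin a) :
    moveField f c.1 c.2 = f c := by
  rw [moveField, dif_pos ⟨c.1.2, c.2.2⟩]

theorem moveField_of_not {a : ℕ} (f : Fin a × Fin a → Fin 3) {p q : ℕ} (h : ¬ (p < a ∧ q < a)) :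
    moveField f p q = 3 := by
  rw [moveField, dif_neg h]

theorem isMove_moveField {a : ℕ} {x : Equiv.Perm (Fin a × Fin a) × (Fin a × Fin a → Fin 3)}
    (hx : x ∈ movePairs a) (c : Fin a × Fin a) :
    IsMove (moveField x.2 c.1 c.2) c.1 c.2 (x.1 c).1 (x.1 c).2 := by
  rw [moveField_coe]
  exact hx c

theorem isMoveField_moveField {a : ℕ}
    {x : Equiv.Perm (Fin a × Fin a) × (Fin a × Fin a → Fin 3)} (hx : x ∈ movePairs a) :
    IsMoveField a (moveField x.2) where
  le_two p q hp hq := by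
    rw [moveField, dif_pos ⟨hp, hq⟩]
    omega
  out p q hpq := moveField_of_not _ (by omega)
  top p q hq := by
    intro h2
    by_cases hp : p < a
    · have h := isMove_moveField hx (⟨p, hp⟩, ⟨q, by omega⟩)
      simp only [h2, IsMove] at h
      omega
    · rw [moveField_of_not _ (by omega)] at h2
      omega
  incoming p q hp hq := by
    obtain ⟨c, hc⟩ := x.1.surjective (⟨p, hp⟩, ⟨q, hq⟩)
    have hmove := isMove_moveField hx c
    rw [hc] at hmove
    have key : ∀ p' q', p' < a → q' < a → IsMove (moveField x.2 p' q') p' q' p q →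
        p' = c.1 ∧ q' = c.2 := by
      intro p' q' hp' hq' h
      have h' := isMove_moveField hx (⟨p', hp'⟩, ⟨q', hq'⟩)
      obtain ⟨e1, e2⟩ := h.unique h'
      have e : x.1 (⟨p', hp'⟩, ⟨q', hq'⟩) = x.1 c := by
        rw [hc]
        exact Prod.ext (Fin.ext e1.symm) (Fin.ext e2.symm)
      rw [← x.1.injective e]
      exact ⟨rfl, rfl⟩
    have h3 : ∀ p' q', a ≤ p' ∨ a ≤ q' → moveField x.2 p' q' = 3 := fun p' q' h =>
      moveField_of_not _ (by omega)
    obtain ⟨⟨p₀, hp₀⟩, ⟨q₀, hq₀⟩⟩ := c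
    simp only at hmove key
    have k1 : moveField x.2 p q = 0 → p = p₀ ∧ q = q₀ := fun h =>
      key p q hp hq (Or.inl ⟨h, rfl, rfl⟩)
    have k2 : moveField x.2 (p + 1) q = 1 → p + 1 = p₀ ∧ q = q₀ := by
      intro h
      by_cases hp1 : p + 1 < a
      · exact key (p + 1) q hp1 hq (Or.inr (Or.inr (Or.inl ⟨h, rfl, rfl⟩)))
      · rw [h3 (p + 1) q (by omega)] at h
        omega
    have k3 : q = 0 → moveField x.2 0 p = 1 → 0 = p₀ ∧ p = q₀ := fun hq0 h =>
      key 0 p (by omega) hp (Or.inr (Or.inl ⟨h, rfl, rfl, hq0⟩))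
    have k4 : q ≠ 0 → moveField x.2 p (q - 1) = 2 → p = p₀ ∧ q - 1 = q₀ := fun hq0 h =>
      key p (q - 1) hp (by omega) (Or.inr (Or.inr (Or.inr ⟨h, rfl, by omega⟩)))
    have k5 : p = 0 → q = 0 → moveField x.2 0 p = moveField x.2 p q := by
      rintro rfl rfl
      rfl
    clear key h3 hc
    rcases hmove with ⟨h0, rfl, rfl⟩ | ⟨h0, rfl, rfl, rfl⟩ | ⟨h0, rfl, rfl⟩ | ⟨h0, rfl, rfl⟩
    · split_ifs <;> omega
    · rw [if_pos rfl]
      split_ifs <;> omega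
    · split_ifs <;> omega
    · rw [Nat.add_sub_cancel] at k4 ⊢
      rw [if_neg (Nat.succ_ne_zero _)]
      split_ifs <;> omega

theorem IsMoveField.exists_isMove {a : ℕ} {F : ℕ → ℕ → ℕ} (hF : IsMoveField a F)
    (c : Fin a × Fin a) : ∃ c' : Fin a × Fin a, IsMove (F c.1 c.2) c.1 c.2 c'.1 c'.2 := by
  obtain ⟨⟨p, hp⟩, ⟨q, hq⟩⟩ := c
  have h1 := hF.le_two p q hp hq
  have h2 := hF.top p q
  unfold IsMove
  rcases (by omega : F p q = 0 ∨ (F p q = 1 ∧ p = 0) ∨ (F p q = 1 ∧ 0 < p) ∨ F p q = 2) with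
    h | h | h | h
  · exact ⟨(⟨p, hp⟩, ⟨q, hq⟩), Or.inl ⟨h, rfl, rfl⟩⟩
  · exact ⟨(⟨q, hq⟩, ⟨0, by omega⟩), Or.inr (Or.inl ⟨h.1, h.2, rfl, rfl⟩)⟩
  · exact ⟨(⟨p - 1, by omega⟩, ⟨q, hq⟩),
      Or.inr (Or.inr (Or.inl ⟨h.1, Nat.sub_add_cancel h.2, rfl⟩))⟩
  · exact ⟨(⟨p, hp⟩, ⟨q + 1, by omega⟩), Or.inr (Or.inr (Or.inr ⟨h, rfl, rfl⟩))⟩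

theorem IsMoveField.source_unique {a : ℕ} {F : ℕ → ℕ → ℕ} (hF : IsMoveField a F)
    {p q p₁ q₁ p₂ q₂ : ℕ} (hp : p < a) (hq : q < a) (h₁ : IsMove (F p₁ q₁) p₁ q₁ p q)
    (h₂ : IsMove (F p₂ q₂) p₂ q₂ p q) : p₁ = p₂ ∧ q₁ = q₂ := by
  have h := hF.incoming p q hp hq
  rcases h₁ with ⟨h1, rfl, rfl⟩ | ⟨h1, rfl, rfl, rfl⟩ | ⟨h1, rfl, rfl⟩ | ⟨h1, rfl, rfl⟩
  all_goals
    rcases h₂ with ⟨h2, e, e'⟩ | ⟨h2, rfl, e, e'⟩ | ⟨h2, e, e'⟩ | ⟨h2, e, e'⟩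
  all_goals
    try subst e
    try subst e'
    try simp only [if_pos, Nat.add_sub_cancel, if_neg (Nat.succ_ne_zero _)] at h
    try split_ifs at h
    all_goals omega

theorem ncard_movePairs (a : ℕ) : (movePairs a).ncard = {F | IsMoveField a F}.ncard := by
  refine Set.ncard_congr (fun x _ => moveField x.2) (fun x hx => isMoveField_moveField hx) ?_ ?_
  · rintro ⟨σ, f⟩ ⟨σ', f'⟩ hx hx' heq
    have hf : f = f' := by
      ext c
      rw [← moveField_coe f, ← moveField_coe f']
      exact congrFun (congrFun heq _) _
    subst hf
    refine Prod.ext ?_ rfl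
    ext1 c
    have := (hx c).unique (hx' c)
    exact Prod.ext (Fin.ext this.1) (Fin.ext this.2)
  · intro F (hF : IsMoveField a F)
    choose g hg using hF.exists_isMove
    -- Each cell has only one incoming move, so the targets of the moves form a permutation.
    have hinj : Function.Injective g := by
      intro c c' h
      have h1 := hg c
      have h2 := hg c'
      rw [← h] at h2
      have := hF.source_unique (g c).1.2 (g c).2.2 h1 h2
      exact Prod.ext (Fin.ext this.1) (Fin.ext this.2)
    refine ⟨(Equiv.ofBijective g (Finite.injective_iff_bijective.1 hinj),
      fun c => ⟨F c.1 c.2, Nat.lt_succ_of_le (hF.le_two _ _ c.1.2 c.2.2)⟩), fun c => hg c, ?_⟩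
    ext p q
    by_cases h : p < a ∧ q < a
    · exact moveField_coe _ (⟨p, h.1⟩, ⟨q, h.2⟩)
    · rw [moveField_of_not _ h, hF.out p q (by omega)]

/-! ### The permutations are even -/

/-- The product of the periods is an odd exponent annihilating `σ`, and an odd power of -1 is not 1.
-/
theorem sign_eq_one_of_odd_period {α : Type*} [Fintype α] [DecidableEq α] {σ : Equiv.Perm α}
    (h : ∀ c, ∃ n, Odd n ∧ (σ ^ n) c = c) : Equiv.Perm.sign σ = 1 := by
  choose n hn hc using h
  have hodd : Odd (∏ c, n c) :=
    Finset.prod_induction n Odd (fun _ _ => Odd.mul) odd_one fun c _ => hn c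
  have h1 : σ ^ ∏ c, n c = 1 := by
    ext c
    obtain ⟨k, hk⟩ := Finset.dvd_prod_of_mem n (Finset.mem_univ c)
    rw [hk, pow_mul, Equiv.Perm.pow_apply_eq_self_of_apply_eq_self (hc c), Equiv.Perm.one_apply]
  have h2 := congrArg Equiv.Perm.sign h1
  rw [map_pow, map_one] at h2
  rcases Int.units_eq_one_or (Equiv.Perm.sign σ) with h | h
  · exact h
  · rw [h, hodd.neg_one_pow] at h2
    exact absurd h2 (by decide)

/-- A path of nonzero moves goes left and up until it crosses the centre from the side `p = 0`. It
never meets a cell with move 0, which would have a second incoming move, and uniqueness of incoming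
moves also keeps the height constant along it. -/
theorem exists_pow_eq_of_mem_movePairs {a : ℕ}
    {x : Equiv.Perm (Fin a × Fin a) × (Fin a × Fin a → Fin 3)} (hx : x ∈ movePairs a) (n : ℕ) :
    ∀ c : Fin a × Fin a, (c.1 : ℕ) + (a - c.2) ≤ n → moveField x.2 c.1 c.2 ≠ 0 →
      ∃ k : ℕ, ∃ c' : Fin a × Fin a, (x.1 ^ k) c = c' ∧ (c'.1 : ℕ) = 0 ∧
        k + c.2 = c'.2 + c.1 ∧ moveField x.2 c'.1 c'.2 = 1 ∧
        moveHeight a (moveField x.2) c'.1 c'.2 = moveHeight a (moveField x.2) c.1 c.2 := by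
  have hF := isMoveField_moveField hx
  induction n with
  | zero =>
    intro c hc
    omega
  | succ n ih =>
    intro c hn h0
    have hm := isMove_moveField hx c
    have hin := hF.incoming (x.1 c).1 (x.1 c).2 (x.1 c).1.2 (x.1 c).2.2
    have hfin : ∀ k' (c' : Fin a × Fin a), (x.1 ^ k') (x.1 c) = c' → (x.1 ^ (k' + 1)) c = c' := by
      intro k' c' h
      rw [pow_succ, Equiv.Perm.mul_apply, h]
    rcases hm with ⟨h1, -, -⟩ | ⟨h1, h2, h3, h4⟩ | ⟨h1, h2, h3⟩ | ⟨h1, h2, h3⟩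
    · exact absurd h1 h0
    · exact ⟨0, c, rfl, h2, by omega, h1, rfl⟩
    · rw [h2, h3, if_pos h1] at hin
      have hH := hF.moveHeight_eq_left (x.1 c).1.2 (x.1 c).2.2.le
      rw [h2, h3] at hH
      obtain ⟨k, c', e1, e2, e3, e4, e5⟩ := ih (x.1 c) (by omega) (by
        rw [h3]
        intro h
        rw [if_pos h] at hin
        omega)
      refine ⟨k + 1, c', hfin k c' e1, e2, by omega, e4, ?_⟩
      rw [e5, h3]
      omega
    · have hH := hF.moveHeight_eq_right c.1 c.2
      rw [h1, if_neg (by norm_num)] at hH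
      rw [h2, h3, if_neg (Nat.succ_ne_zero _), Nat.add_sub_cancel, if_pos h1] at hin
      obtain ⟨k, c', e1, e2, e3, e4, e5⟩ := ih (x.1 c) (by omega) (by
        rw [h2, h3]
        intro h
        rw [if_pos h] at hin
        omega)
      refine ⟨k + 1, c', hfin k c' e1, e2, by omega, e4, ?_⟩
      rw [e5, h2, h3]
      omega

/-- After crossing from `(0, q)` the path restarts at `(q, 0)`, where the symmetric height has the
same value. On the side `p = 0` the height drops strictly after each crossing, so its value
determines the crossing and the next one is again at `(0, q)`. -/
theorem exists_odd_period_of_mem_movePairs {a : ℕ}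
    {x : Equiv.Perm (Fin a × Fin a) × (Fin a × Fin a → Fin 3)} (hx : x ∈ movePairs a)
    (c : Fin a × Fin a) : ∃ n, Odd n ∧ (x.1 ^ n) c = c := by
  have hF := isMoveField_moveField hx
  by_cases h0 : moveField x.2 c.1 c.2 = 0
  · refine ⟨1, odd_one, ?_⟩
    have hm := isMove_moveField hx c
    rw [h0] at hm
    unfold IsMove at hm
    rw [pow_one]
    exact Prod.ext (Fin.ext (by omega)) (Fin.ext (by omega))
  obtain ⟨k, c₁, h1, h2, h3, h4, h5⟩ := exists_pow_eq_of_mem_movePairs hx _ c le_rfl h0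
  have hm := isMove_moveField hx c₁
  have h4' := h4
  rw [h2] at h4'
  unfold IsMove at hm
  have hp : ((x.1 c₁).1 : ℕ) = c₁.2 := by omega
  have hq : ((x.1 c₁).2 : ℕ) = 0 := by omega
  have hin := hF.incoming (x.1 c₁).1 (x.1 c₁).2 (x.1 c₁).1.2 (x.1 c₁).2.2
  rw [hp, hq, if_pos rfl, if_pos h4'] at hin
  obtain ⟨k', c₂, e1, e2, e3, e4, e5⟩ := exists_pow_eq_of_mem_movePairs hx _ (x.1 c₁) le_rfl (by
    rw [hp, hq]
    intro h
    rw [if_pos h] at hin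
    omega)
  have hcc : c₂ = c₁ := by
    refine Prod.ext (Fin.ext (by omega)) (Fin.ext ?_)
    have hs := hF.isHeight.symm c₁.2
    rw [hp, hq, hs, e2] at e5
    have r1 := hF.moveHeight_eq_right 0 c₁.2
    have r2 := hF.moveHeight_eq_right 0 c₂.2
    rw [if_pos h4'] at r1
    rw [e2] at e4
    rw [if_pos e4] at r2
    by_contra hne
    rcases lt_or_gt_of_ne hne with hlt | hlt
    · have := hF.isHeight.anti (le_refl 0) (show (c₂.2 : ℕ) + 1 ≤ c₁.2 from hlt)
      omega
    · have := hF.isHeight.anti (le_refl 0) (show (c₁.2 : ℕ) + 1 ≤ c₂.2 from hlt)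
      omega
  rw [hcc] at e1 e3
  refine ⟨k' + 1, ?_, ?_⟩
  · rw [hp, hq] at e3
    -- The cycle consists of `q` steps left, `q` steps up and one crossing, with `q = c₁.2`.
    exact ⟨c₁.2, by omega⟩
  · have hc₁ : (x.1 ^ (k' + 1)) c₁ = c₁ := by
      rw [pow_succ, Equiv.Perm.mul_apply, e1]
    refine (x.1 ^ k).injective ?_
    rw [← Equiv.Perm.mul_apply, ← pow_add, add_comm, pow_add, Equiv.Perm.mul_apply, h1, hc₁]

theorem det_rhombusMatrix_eq_N3 (a : ℕ) : (rhombusMatrix a).det = N3 a := by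
  classical
  rw [N3_eq_ncard_isHeight, ← ncard_isMoveField, ← ncard_movePairs, det_rhombusMatrix_eq_sum,
    Set.ncard_eq_toFinset_card', Finset.card_eq_sum_ones, ← Finset.sum_filter]
  push_cast
  refine Finset.sum_congr (by ext; simp) fun x hx => ?_
  rw [Set.mem_toFinset] at hx
  rw [sign_eq_one_of_odd_period (exists_odd_period_of_mem_movePairs hx)]
  simp

/-! ### From side `a` to side `a + 1` -/

/-- The first coordinate of the cell `r` of the ring around the rhombus of side `a`. -/
def ringFst (a r : ℕ) : ℕ := min a (2 * a - r)

/-- The second coordinate of the cell `r` of the ring around the rhombus of side `a`. -/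
def ringSnd (a r : ℕ) : ℕ := min a r

/-- The cells of the rhombus of side `a + 1`: those of the rhombus of side `a`, the first cell of
the ring around it, and the other cells of the ring. -/
def ringIndex (a : ℕ) : ((Fin a × Fin a) ⊕ Unit) ⊕ Fin (2 * a) → Fin (a + 1) × Fin (a + 1)
  | Sum.inl (Sum.inl c) => (c.1.castSucc, c.2.castSucc)
  | Sum.inl (Sum.inr _) => (Fin.last a, 0)
  | Sum.inr s => (⟨ringFst a (s + 1), by unfold ringFst; omega⟩,
      ⟨ringSnd a (s + 1), by unfold ringSnd; omega⟩)

theorem ringIndex_bijective (a : ℕ) : Function.Bijective (ringIndex a) := by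
  rw [Fintype.bijective_iff_injective_and_card]
  constructor
  · rintro ((⟨p, q⟩ | _) | s) ((⟨p', q'⟩ | _) | s') h
    all_goals
      simp only [ringIndex, ringFst, ringSnd, Prod.ext_iff, Fin.ext_iff, Fin.val_castSucc,
        Fin.val_last, Fin.val_zero] at h
      simp only [Sum.inl.injEq, Sum.inr.injEq, Prod.ext_iff, Fin.ext_iff, reduceCtorEq]
      try omega
  · simp only [Fintype.card_sum, Fintype.card_prod, Fintype.card_fin, Fintype.card_unit]
    ring

/-- The transition matrix of the ring without its first cell. -/
def ringMatrix (n : ℕ) : Matrix (Fin n) (Fin n) ℚ :=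
  Matrix.of fun s' s => (if (s' : ℕ) = s then 1 else 0) + (if (s' : ℕ) = s + 1 then 1 else 0)

theorem det_ringMatrix (n : ℕ) : (ringMatrix n).det = 1 := by
  rw [Matrix.det_of_isLowerTriangular]
  · refine Finset.prod_eq_one fun s _ => ?_
    rw [ringMatrix, Matrix.of_apply, if_pos rfl, if_neg (by omega), add_zero]
  · intro s' s h
    have h : s' < s := h
    rw [ringMatrix, Matrix.of_apply, if_neg (by omega), if_neg (by omega), add_zero]

/-- The column of signs along the side `p = a - 1` of the rhombus. -/
def sideColumn (a : ℕ) : Matrix (Fin a × Fin a) Unit ℚ :=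
  Matrix.of fun c _ => if (c.1 : ℕ) + 1 = a then (-1) ^ (c.2 : ℕ) else 0

/-- The row of signs along the side `q = a - 1` of the rhombus. -/
def sideRow (a : ℕ) : Matrix Unit (Fin a × Fin a) ℚ :=
  Matrix.of fun _ c => if (c.2 : ℕ) + 1 = a then -(-1) ^ (c.1 : ℕ) else 0

/-- The coefficients which eliminate the ring. -/
def ringElimination (a : ℕ) : Matrix (Fin (2 * a)) ((Fin a × Fin a) ⊕ Unit) ℚ :=
  Matrix.of fun s j => match j with
    | Sum.inl c =>
      if (c.2 : ℕ) + 1 = a ∧ 2 * a ≤ s + 1 + c.1 then (-1) ^ ((s : ℕ) + 1 + c.1) else 0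
    | Sum.inr _ => (-1) ^ (s : ℕ)

theorem ringMatrix_mul_apply {n : ℕ} {ι : Type*} (Z : Matrix (Fin n) ι ℚ) (s : Fin n) (j : ι) :
    (ringMatrix n * Z) s j = Z s j +
      if h : 0 < (s : ℕ) then Z ⟨s - 1, by omega⟩ j else 0 := by
  rw [Matrix.mul_apply]
  simp only [ringMatrix, Matrix.of_apply, add_mul, ite_mul, one_mul, zero_mul,
    Finset.sum_add_distrib]
  congr 1
  · rw [Finset.sum_eq_single s]
    · rw [if_pos rfl]
    · intro b _ hb
      rw [if_neg]
      exact fun h => hb (Fin.ext h.symm)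
    · simp
  · split_ifs with h
    · rw [Finset.sum_eq_single ⟨s - 1, by omega⟩]
      · rw [if_pos]
        simp only
        omega
      · intro b _ hb
        rw [if_neg]
        exact fun h => hb (Fin.ext (by simp only; omega))
      · simp
    · exact Finset.sum_eq_zero fun b _ => if_neg (by omega)

/-- Where the three kinds of move have distinct targets, an entry is 0 or 1. This covers all entries
involving the ring once `a ≥ 1`, the double edge being at `(0, 0)`. -/
theorem rhombusEntry_eq_ite {P : Prop} [Decidable P] {p' q' p q : ℕ}
    (h₁ : p' = p ∧ q' = q → ¬ ((p = 0 ∧ p' = q ∧ q' = 0) ∨ (p' + 1 = p ∧ q' = q)))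
    (h₂ : p' = p ∧ q' = q → ¬ (p' = p ∧ q' = q + 1))
    (h₃ : (p = 0 ∧ p' = q ∧ q' = 0) ∨ (p' + 1 = p ∧ q' = q) → ¬ (p' = p ∧ q' = q + 1))
    (hP : (p' = p ∧ q' = q) ∨ ((p = 0 ∧ p' = q ∧ q' = 0) ∨ (p' + 1 = p ∧ q' = q)) ∨
      (p' = p ∧ q' = q + 1) ↔ P) :
    rhombusEntry p' q' p q = if P then 1 else 0 := by
  rw [rhombusEntry, ← ite_or_or h₁ h₂ h₃]
  exact if_congr hP rfl rfl

theorem ringMatrix_eq {a : ℕ} (s' s : Fin (2 * a)) :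
    rhombusEntry (ringFst a (s' + 1)) (ringSnd a (s' + 1)) (ringFst a (s + 1)) (ringSnd a (s + 1)) =
      ringMatrix (2 * a) s' s := by
  obtain ⟨s, hs⟩ := s
  obtain ⟨s', hs'⟩ := s'
  rw [ringMatrix, Matrix.of_apply]
  dsimp only
  rw [rhombusEntry_eq_ite (P := s' = s ∨ s' = s + 1)
    (by unfold ringFst ringSnd; omega) (by unfold ringFst ringSnd; omega)
    (by unfold ringFst ringSnd; omega) (by unfold ringFst ringSnd; omega)]
  by_cases h1 : s' = s <;> by_cases h2 : s' = s + 1 <;> simp [h1, h2]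

theorem rhombusEntry_ring_inner {a : ℕ} (s : Fin (2 * a)) (c : Fin a × Fin a) :
    rhombusEntry (ringFst a (s + 1)) (ringSnd a (s + 1)) c.1 c.2 =
      if (c.2 : ℕ) + 1 = a ∧ (s : ℕ) + 1 + c.1 = 2 * a then 1 else 0 := by
  obtain ⟨s, hs⟩ := s
  obtain ⟨⟨p, hp⟩, ⟨q, hq⟩⟩ := c
  exact rhombusEntry_eq_ite (by unfold ringFst ringSnd; omega) (by unfold ringFst ringSnd; omega)
    (by unfold ringFst ringSnd; omega) (by unfold ringFst ringSnd; omega)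

theorem rhombusEntry_ring_first {a : ℕ} (s : Fin (2 * a)) :
    rhombusEntry (ringFst a (s + 1)) (ringSnd a (s + 1)) a 0 =
      if (s : ℕ) = 0 then 1 else 0 := by
  obtain ⟨s, hs⟩ := s
  exact rhombusEntry_eq_ite (by unfold ringFst ringSnd; omega) (by unfold ringFst ringSnd; omega)
    (by unfold ringFst ringSnd; omega) (by unfold ringFst ringSnd; omega)

theorem rhombusEntry_inner_ring {a : ℕ} (c : Fin a × Fin a) (s : Fin (2 * a)) :
    rhombusEntry c.1 c.2 (ringFst a (s + 1)) (ringSnd a (s + 1)) =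
      if (c.1 : ℕ) + 1 = a ∧ (c.2 : ℕ) = s + 1 then 1 else 0 := by
  obtain ⟨s, hs⟩ := s
  obtain ⟨⟨p, hp⟩, ⟨q, hq⟩⟩ := c
  exact rhombusEntry_eq_ite (by unfold ringFst ringSnd; omega) (by unfold ringFst ringSnd; omega)
    (by unfold ringFst ringSnd; omega) (by unfold ringFst ringSnd; omega)

theorem rhombusEntry_first_ring {a : ℕ} (s : Fin (2 * a)) :
    rhombusEntry a 0 (ringFst a (s + 1)) (ringSnd a (s + 1)) =
      if (s : ℕ) + 1 = 2 * a then 1 else 0 := by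
  obtain ⟨s, hs⟩ := s
  exact rhombusEntry_eq_ite (by unfold ringFst ringSnd; omega) (by unfold ringFst ringSnd; omega)
    (by unfold ringFst ringSnd; omega) (by unfold ringFst ringSnd; omega)

theorem rhombusEntry_inner_first {a : ℕ} (c : Fin a × Fin a) :
    rhombusEntry c.1 c.2 a 0 =
      if (c.1 : ℕ) + 1 = a ∧ (c.2 : ℕ) = 0 then 1 else 0 := by
  obtain ⟨⟨p, hp⟩, ⟨q, hq⟩⟩ := c
  exact rhombusEntry_eq_ite (by omega) (by omega)
    (by omega) (by omega)

theorem rhombusEntry_first_inner {a : ℕ} (c : Fin a × Fin a) :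
    rhombusEntry a 0 c.1 c.2 = 0 := by
  obtain ⟨⟨p, hp⟩, ⟨q, hq⟩⟩ := c
  exact (rhombusEntry_eq_ite (P := False) (by omega) (by omega) (by omega)
    (by rw [iff_false]; dsimp only; omega)).trans (if_neg not_false)

theorem rhombusEntry_first_first {a : ℕ} (ha : 1 ≤ a) : rhombusEntry a 0 a 0 = 1 :=
  (rhombusEntry_eq_ite (P := True) (by omega) (by omega) (by omega)
    (by rw [iff_true]; omega)).trans (if_pos trivial)

/-- The block of the rhombus matrix of side `a + 1` whose rows are not in the ring and whose
columns are in the ring. -/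
def ringColumns (a : ℕ) : Matrix ((Fin a × Fin a) ⊕ Unit) (Fin (2 * a)) ℚ :=
  Matrix.of fun j s => match j with
    | Sum.inl c => if (c.1 : ℕ) + 1 = a ∧ (c.2 : ℕ) = s + 1 then 1 else 0
    | Sum.inr _ => if (s : ℕ) + 1 = 2 * a then 1 else 0

/-- The block of the rhombus matrix of side `a + 1` whose rows and columns are not in the ring,
after the elimination of the ring. -/
def eliminatedMatrix (a : ℕ) : Matrix ((Fin a × Fin a) ⊕ Unit) ((Fin a × Fin a) ⊕ Unit) ℚ :=
  Matrix.fromBlocks (rhombusMatrix a) (sideColumn a) (sideRow a) (Matrix.of fun _ _ => 2)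

/-- The correction subtracted in the Schur complement. The inner block vanishes: edges to the inner
rhombus come from the side `p = a` of the ring, before the signs propagated from the side `q = a -
1` of the inner rhombus begin. -/
theorem ringColumns_mul_ringElimination {a : ℕ} (ha : 1 ≤ a) :
    ringColumns a * ringElimination a =
      Matrix.fromBlocks 0 (Matrix.of fun c _ => if (c.1 : ℕ) + 1 = a ∧ (c.2 : ℕ) ≠ 0 then
        -(-1) ^ (c.2 : ℕ) else 0) (-sideRow a) (Matrix.of fun _ _ => -1) := by
  ext (c | _) j
  · by_cases h : (c.1 : ℕ) + 1 = a ∧ (c.2 : ℕ) ≠ 0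
    · have hlt := c.2.2
      have e : (ringColumns a * ringElimination a) (Sum.inl c) j =
          ringElimination a ⟨c.2 - 1, by omega⟩ j := by
        rw [Matrix.mul_apply, Finset.sum_eq_single ⟨c.2 - 1, by omega⟩]
        · simp only [ringColumns, Matrix.of_apply]
          rw [if_pos ⟨h.1, by omega⟩, one_mul]
        · intro s _ hs
          simp only [ringColumns, Matrix.of_apply]
          rw [if_neg, zero_mul]
          rintro ⟨-, h2⟩
          exact hs (Fin.ext (by simp only; omega))
        · simp
      rw [e]
      rcases j with c' | _
      · simp only [ringElimination, Matrix.of_apply, Matrix.fromBlocks_apply₁₁, Matrix.zero_apply]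
        exact if_neg (by omega)
      · simp only [ringElimination, Matrix.of_apply, Matrix.fromBlocks_apply₁₂]
        rw [if_pos h]
        obtain ⟨k, hk⟩ := Nat.exists_eq_succ_of_ne_zero h.2
        rw [hk, Nat.succ_sub_one, Nat.succ_eq_add_one, pow_succ]
        ring
    · have e : (ringColumns a * ringElimination a) (Sum.inl c) j = 0 := by
        rw [Matrix.mul_apply]
        refine Finset.sum_eq_zero fun s _ => ?_
        simp only [ringColumns, Matrix.of_apply]
        rw [if_neg (by omega), zero_mul]
      rw [e]
      rcases j with c' | _
      · rfl
      · simp only [Matrix.of_apply, Matrix.fromBlocks_apply₁₂]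
        rw [if_neg h]
  · have e : (ringColumns a * ringElimination a) (Sum.inr ()) j =
        ringElimination a ⟨2 * a - 1, by omega⟩ j := by
      rw [Matrix.mul_apply, Finset.sum_eq_single ⟨2 * a - 1, by omega⟩]
      · simp only [ringColumns, Matrix.of_apply]
        rw [if_pos (by omega), one_mul]
      · intro s _ hs
        simp only [ringColumns, Matrix.of_apply]
        rw [if_neg, zero_mul]
        intro h2
        exact hs (Fin.ext (by simp only; omega))
      · simp
    refine e.trans ?_
    have h2a : 2 * a - 1 + 1 = 2 * a := by omega
    rcases j with c | _
    · simp only [ringElimination, Matrix.of_apply, Matrix.fromBlocks_apply₂₁, Matrix.neg_apply,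
        sideRow, h2a]
      by_cases h : (c.2 : ℕ) + 1 = a
      · rw [if_pos h, if_pos ⟨h, by omega⟩, neg_neg, pow_add, pow_mul]
        norm_num
      · rw [if_neg h, if_neg fun h' => h h'.1, neg_zero]
    · simp only [ringElimination, Matrix.of_apply, Matrix.fromBlocks_apply₂₂]
      exact Odd.neg_one_pow ⟨a - 1, by omega⟩

/-- `ringElimination` is obtained by forward substitution in the bidiagonal `ringMatrix`, whence its
alternating signs. The corner of the complement is `1 - (-1) = 2`, since the ring closes up after `2
* a` further cells. -/
theorem submatrix_ringIndex {a : ℕ} (ha : 1 ≤ a) :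
    (rhombusMatrix (a + 1)).submatrix (ringIndex a) (ringIndex a) =
      Matrix.fromBlocks (eliminatedMatrix a + ringColumns a * ringElimination a) (ringColumns a)
        (ringMatrix (2 * a) * ringElimination a) (ringMatrix (2 * a)) := by
  rw [ringColumns_mul_ringElimination ha, eliminatedMatrix, Matrix.fromBlocks_add]
  ext (i | s') (j | s)
  · rcases i with c' | _ <;> rcases j with c | _
    · simp [rhombusMatrix, ringIndex]
    · have h := rhombusEntry_inner_first c'
      simp only [rhombusMatrix, ringIndex, Matrix.submatrix_apply, Matrix.of_apply,
        Matrix.fromBlocks_apply₁₁, Matrix.fromBlocks_apply₁₂, Matrix.add_apply, sideColumn,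
        Fin.val_castSucc, Fin.val_last, Fin.val_zero, h]
      by_cases h1 : (c'.1 : ℕ) + 1 = a <;> by_cases h2 : (c'.2 : ℕ) = 0 <;> simp [h1, h2]
    · have h := rhombusEntry_first_inner c
      simp only [rhombusMatrix, ringIndex, Matrix.submatrix_apply, Matrix.of_apply,
        Matrix.fromBlocks_apply₁₁, Matrix.fromBlocks_apply₂₁,
        Fin.val_castSucc, Fin.val_last, Fin.val_zero, h]
      exact (add_neg_cancel _).symm
    · have h := rhombusEntry_first_first ha
      simp only [rhombusMatrix, ringIndex, Matrix.submatrix_apply, Matrix.of_apply,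
        Matrix.fromBlocks_apply₁₁, Matrix.fromBlocks_apply₂₂, Matrix.add_apply,
        Fin.val_last, Fin.val_zero, h]
      norm_num
  · rcases i with c' | _
    · exact rhombusEntry_inner_ring c' s
    · exact rhombusEntry_first_ring s
  · rw [Matrix.fromBlocks_apply₂₁, ringMatrix_mul_apply]
    rcases j with c | _
    · refine (rhombusEntry_ring_inner s' c).trans ?_
      have hc := c.1.2
      simp only [ringElimination, Matrix.of_apply]
      by_cases h : (c.2 : ℕ) + 1 = a
      · rcases lt_trichotomy ((s' : ℕ) + 1 + c.1) (2 * a) with hlt | heq | hgt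
        · rw [if_neg (by omega), if_neg (by omega), zero_add]
          split_ifs <;> first | omega | rfl
        · rw [if_pos ⟨h, heq⟩, if_pos ⟨h, heq.ge⟩, heq, Even.neg_one_pow ⟨a, by ring⟩]
          split_ifs <;> first | omega | norm_num
        · rw [if_neg (by omega), if_pos ⟨h, hgt.le⟩, dif_pos (by omega), if_pos ⟨h, by omega⟩,
            show (s' : ℕ) - 1 + 1 + c.1 = s' + c.1 by omega, add_right_comm, pow_succ]
          ring
      · rw [if_neg (by omega), if_neg (by omega)]
        split_ifs <;> first | omega | norm_num
    · refine (rhombusEntry_ring_first s').trans ?_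
      simp only [ringElimination, Matrix.of_apply]
      obtain ⟨_ | k, hk⟩ := s'
      · simp
      · simp only [Nat.succ_ne_zero, if_false, Nat.zero_lt_succ, dif_pos, Nat.add_sub_cancel,
          pow_succ]
        ring
  · exact ringMatrix_eq s' s

theorem det_rhombusMatrix_succ {a : ℕ} (ha : 1 ≤ a) :
    (rhombusMatrix (a + 1)).det = (eliminatedMatrix a).det := by
  rw [← Matrix.det_submatrix_equiv_self (Equiv.ofBijective _ (ringIndex_bijective a))]
  refine (congrArg Matrix.det (submatrix_ringIndex ha)).trans ?_
  have h : Matrix.fromBlocks (eliminatedMatrix a + ringColumns a * ringElimination a)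
      (ringColumns a) (ringMatrix (2 * a) * ringElimination a) (ringMatrix (2 * a)) =
      Matrix.fromBlocks (eliminatedMatrix a) (ringColumns a) 0 (ringMatrix (2 * a)) *
        Matrix.fromBlocks 1 0 (ringElimination a) 1 := by
    rw [Matrix.fromBlocks_multiply]
    simp
  rw [h, Matrix.det_mul, Matrix.det_fromBlocks_zero₂₁, Matrix.det_fromBlocks_zero₁₂,
    det_ringMatrix]
  simp

theorem det_fromBlocks_unit {n : Type*} [Fintype n] [DecidableEq n] (K : Matrix n n ℚ)
    (v : Matrix n Unit ℚ) (β : Matrix Unit n ℚ) (d : Matrix Unit Unit ℚ) :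
    (Matrix.fromBlocks K v (-(β * K)) d).det = K.det * (d () () + (β * v) () ()) := by
  have h : Matrix.fromBlocks K v (-(β * K)) d =
      Matrix.fromBlocks 1 0 (-β) 1 * Matrix.fromBlocks K v 0 (d + β * v) := by
    rw [Matrix.fromBlocks_multiply]
    simp
  rw [h, Matrix.det_mul, Matrix.det_fromBlocks_zero₂₁, Matrix.det_fromBlocks_zero₁₂]
  simp

/-! ### The matrix `R3` on the fundamental rhombus -/

/-- Counting gives the sign and the product formula gives nonvanishing. -/
theorem det_rhombusMatrix_pos (a : ℕ) : 0 < (rhombusMatrix a).det := by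
  have h := abs_det_rhombusMatrix a
  have h1 : (0 : ℚ) < stagHyperfactorial 3 (3 * a + 2) := by
    rw [stagHyperfactorial_three]
    exact_mod_cast Finset.prod_pos fun k _ => (3 * k + 2).factorial_pos
  have h2 : (0 : ℚ) < hyperfactorial a := by exact_mod_cast hyperfactorial_pos a
  have h3 : (0 : ℚ) < hyperfactorial (2 * a) := by exact_mod_cast hyperfactorial_pos (2 * a)
  have h4 : (0 : ℚ) < stagFactorial 3 (3 * (a : ℤ) - 2) := by
    exact_mod_cast stagFactorial_three_pos a
  rw [det_rhombusMatrix_eq_N3, Nat.abs_cast] at h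
  rw [det_rhombusMatrix_eq_N3, h]
  positivity

theorem orbitOf_zNabla {a : ℕ} (i : Fin a) :
    orbitOf (zNabla i) = nablaEquiv a (⟨a - 1, by have := i.2; omega⟩, i) := by
  have h : (zNabla i).coords = (-(a : ℤ), (a : ℤ) - 1 - i, (i : ℤ)) := rfl
  have := i.2
  rw [nablaEquiv_apply, orbitOf_eq_iff_coords, h, coords_nablaCell]
  simp only [rotateCoords, Prod.ext_iff]
  refine Or.inr (Or.inr ⟨?_, trivial, ?_⟩) <;> omega

theorem orbitOf_zDelta {a : ℕ} (i : Fin a) :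
    orbitOf (zDelta i) = deltaEquiv a (⟨a - 1 - i, by have := i.2; omega⟩,
      ⟨a - 1, by have := i.2; omega⟩) := by
  have h : (zDelta i).coords = ((a : ℤ) - 1, -(a : ℤ) + i, -1 - (i : ℤ)) := rfl
  have := i.2
  rw [deltaEquiv_apply, orbitOf_eq_iff_coords, h, coords_deltaCell]
  simp only [rotateCoords, Prod.ext_iff]
  omega

theorem R3_last_column {a : ℕ} (c : Fin a × Fin a) :
    R3 a (Sum.inl (nablaEquiv a c)) (Sum.inr ()) = sideColumn a c () := by
  rw [R3, Matrix.fromBlocks_apply₁₂, Matrix.of_apply, sideColumn, Matrix.of_apply]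
  simp only [orbitOf_zNabla, (nablaEquiv a).injective.eq_iff, Prod.ext_iff, Fin.ext_iff]
  by_cases h : (c.1 : ℕ) + 1 = a
  · rw [if_pos h, Finset.sum_eq_single c.2, if_pos ⟨by omega, rfl⟩]
    · intro i _ hi
      rw [if_neg]
      exact fun h' => hi (Fin.ext h'.2)
    · simp
  · rw [if_neg h]
    exact Finset.sum_eq_zero fun i _ => if_neg (by omega)

/-- The index `i` along the side of the hexagon runs against `p`, namely `i = a - 1 - p`. The
reversal produces the global sign `(-1) ^ a`, which also stands in the corner of `R3`. -/
theorem R3_last_row {a : ℕ} (c : Fin a × Fin a) :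
    R3 a (Sum.inr ()) (Sum.inl (deltaEquiv a c)) = (-1) ^ a * sideRow a () c := by
  rw [R3, Matrix.fromBlocks_apply₂₁, Matrix.of_apply, sideRow, Matrix.of_apply]
  simp only [orbitOf_zDelta, (deltaEquiv a).injective.eq_iff, Prod.ext_iff, Fin.ext_iff]
  have hc := c.1.2
  by_cases h : (c.2 : ℕ) + 1 = a
  · rw [if_pos h, Finset.sum_eq_single ⟨a - 1 - c.1, by omega⟩]
    · simp only
      rw [if_pos (by omega)]
      obtain ⟨k, hk⟩ := Nat.exists_eq_add_of_lt hc
      have e : (-1 : ℚ) ^ (c.1 : ℕ) * (-1) ^ (c.1 : ℕ) = 1 := by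
        rw [← mul_pow]
        norm_num
      rw [show a - 1 - (c.1 : ℕ) = k by omega]
      have e' : (-1 : ℚ) ^ a = (-1) ^ (c.1 : ℕ) * (-1) ^ k * (-1) := by
        rw [← pow_add, ← pow_succ, ← hk]
      rw [e']
      linear_combination (-(-1 : ℚ) ^ k) * e
    · intro i _ hi
      rw [if_neg]
      exact fun h' => hi (Fin.ext (by simp only; omega))
    · simp
  · rw [if_neg h, mul_zero]
    exact Finset.sum_eq_zero fun i _ => if_neg (by omega)

/-- The row of coefficients on the fundamental rhombus. -/
noncomputable def coefficientRow {a : ℕ} (α : NablaOrbit a → ℚ) : Matrix Unit (Fin a × Fin a) ℚ :=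
  Matrix.of fun _ c => α (nablaEquiv a c)

theorem R3'_last_row {a : ℕ} (α : NablaOrbit a → ℚ) (c : Fin a × Fin a) :
    R3' a α (Sum.inr ()) (Sum.inl (deltaEquiv a c)) =
      (coefficientRow α * rhombusMatrix a + (-1 : ℚ) ^ a • sideRow a) () c := by
  rw [R3', Matrix.of_apply, R3_last_row, Matrix.add_apply, Matrix.smul_apply, smul_eq_mul,
    Matrix.mul_apply, ← (nablaEquiv a).sum_comp, ← submatrix_M3_eq_rhombusMatrix]
  rfl

theorem R3'_last_row_eq_zero_iff {a : ℕ} (α : NablaOrbit a → ℚ) :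
    (∀ u, R3' a α (Sum.inr ()) (Sum.inl u) = 0) ↔
      coefficientRow α * rhombusMatrix a = -((-1 : ℚ) ^ a • sideRow a) := by
  rw [← (deltaEquiv a).forall_congr_right, ← add_eq_zero_iff_eq_neg]
  simp only [R3'_last_row]
  constructor
  · intro h
    ext i c
    exact h c
  · intro h c
    rw [h]
    rfl

theorem R3'_last {a : ℕ} (α : NablaOrbit a → ℚ) :
    R3' a α (Sum.inr ()) (Sum.inr ()) =
      (coefficientRow α * sideColumn a) () () + 2 * (-1) ^ a := by
  rw [R3', Matrix.of_apply, Matrix.mul_apply, ← (nablaEquiv a).sum_comp]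
  simp only [R3_last_column]
  rfl

theorem neg_one_pow_mul_self (a : ℕ) : (-1 : ℚ) ^ a * (-1) ^ a = 1 := by
  rw [← mul_pow]
  norm_num

/-- Clearing the last row of `R3` computes the Schur complement of the corner of `eliminatedMatrix`,
up to the sign `(-1) ^ a`. -/
theorem det_rhombusMatrix_succ_eq_mul {a : ℕ} (ha : 1 ≤ a) {α : NablaOrbit a → ℚ}
    (hα : ∀ u, R3' a α (Sum.inr ()) (Sum.inl u) = 0) :
    (rhombusMatrix (a + 1)).det =
      (rhombusMatrix a).det * ((-1) ^ a * R3' a α (Sum.inr ()) (Sum.inr ())) := by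
  rw [R3'_last_row_eq_zero_iff] at hα
  have h : sideRow a = -(((-1 : ℚ) ^ a • coefficientRow α) * rhombusMatrix a) := by
    rw [Matrix.smul_mul, hα, smul_neg, neg_neg, smul_smul, neg_one_pow_mul_self, one_smul]
  rw [det_rhombusMatrix_succ ha, eliminatedMatrix, h, det_fromBlocks_unit, R3'_last,
    Matrix.smul_mul, Matrix.of_apply, Matrix.smul_apply, smul_eq_mul]
  linear_combination (-2 * (rhombusMatrix a).det) * neg_one_pow_mul_self a

/-! ### Quotients of consecutive counts and the final assembly -/

theorem N3_eq_div (a : ℕ) : (N3 a : ℚ) =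
    ((stagHyperfactorial 3 (3 * a + 2) : ℚ) * (hyperfactorial a : ℚ)) /
      ((hyperfactorial (2 * a) : ℚ) * (stagFactorial 3 (3 * (a : ℤ) - 2) : ℚ)) := by
  rw [← abs_det_rhombusMatrix, det_rhombusMatrix_eq_N3, Nat.abs_cast]

theorem N3_succ_eq_mul {a : ℕ} (ha : 1 ≤ a) : (N3 (a + 1) : ℚ) =
    (3 * (a : ℚ) + 2) / a * (((3 * a).choose (a - 1) : ℚ) / ((2 * a).choose a : ℚ)) * N3 a := by
  obtain ⟨b, rfl⟩ := Nat.exists_eq_add_of_le' ha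
  have h2 : (0 : ℚ) < hyperfactorial (b + 1) := by exact_mod_cast hyperfactorial_pos _
  have h3 : (0 : ℚ) < hyperfactorial (2 * (b + 1)) := by exact_mod_cast hyperfactorial_pos _
  have h4 : (0 : ℚ) < stagFactorial 3 (3 * ((b + 1 : ℕ) : ℤ) - 2) := by
    exact_mod_cast stagFactorial_three_pos (b + 1)
  have e1 : stagHyperfactorial 3 (3 * (b + 1 + 1) + 2) =
      stagHyperfactorial 3 (3 * (b + 1) + 2) * (3 * (b + 1) + 2).factorial := by
    rw [stagHyperfactorial_three, stagHyperfactorial_three, Finset.prod_range_succ]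
  have e2 : hyperfactorial (b + 1 + 1) = hyperfactorial (b + 1) * (b + 1).factorial := by
    rw [hyperfactorial_eq_prod_range, hyperfactorial_eq_prod_range, Finset.prod_range_succ]
  have e3 : hyperfactorial (2 * (b + 1 + 1)) =
      hyperfactorial (2 * (b + 1)) * (2 * (b + 1)).factorial * (2 * (b + 1) + 1).factorial := by
    rw [hyperfactorial_eq_prod_range, hyperfactorial_eq_prod_range,
      show 2 * (b + 1 + 1) = 2 * (b + 1) + 1 + 1 by ring, Finset.prod_range_succ,
      Finset.prod_range_succ]
  have e4 : stagFactorial 3 (3 * ((b + 1 + 1 : ℕ) : ℤ) - 2) =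
      stagFactorial 3 (3 * ((b + 1 : ℕ) : ℤ) - 2) * (3 * ((b + 1 : ℕ) : ℤ) + 1) := by
    rw [stagFactorial_three, stagFactorial_three, Finset.prod_range_succ]
  have c1 := Nat.add_choose_mul_factorial_mul_factorial (2 * (b + 1) + 1) b
  have c2 := Nat.add_choose_mul_factorial_mul_factorial (b + 1) (b + 1)
  rw [show 2 * (b + 1) + 1 + b = 3 * (b + 1) by ring] at c1
  rw [show b + 1 + (b + 1) = 2 * (b + 1) by ring] at c2
  have e5 : (3 * (b + 1) + 2).factorial =
      (3 * (b + 1) + 2) * ((3 * (b + 1) + 1) * (3 * (b + 1)).factorial) := by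
    rw [Nat.factorial_succ, Nat.factorial_succ]
  rw [N3_eq_div, N3_eq_div, e1, e2, e3, e4, e5, Nat.add_sub_cancel, ← c1, ← c2,
    Nat.factorial_succ b]
  have f1 : (0 : ℚ) < b.factorial := by exact_mod_cast b.factorial_pos
  have f2 : (0 : ℚ) < (2 * (b + 1) + 1).factorial := by
    exact_mod_cast (2 * (b + 1) + 1).factorial_pos
  have f3 : (0 : ℚ) < (2 * (b + 1)).choose (b + 1) := by
    exact_mod_cast Nat.choose_pos (by omega)
  push_cast at h2 h3 h4 ⊢
  have f4 : (3 * ((b : ℚ) + 1) + 1) ≠ 0 := by positivity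
  field_simp

theorem mainTheorem3 (a : ℕ) :
    ((N3 a : ℚ) =
      ((stagHyperfactorial 3 (3 * a + 2) : ℚ) * (hyperfactorial a : ℚ)) /
        ((hyperfactorial (2 * a) : ℚ) * (stagFactorial 3 (3 * (a : ℤ) - 2) : ℚ))) ∧
    (Nonempty (NablaOrbit a ≃ DeltaOrbit a) ∧ absDet (M3 a) = (N3 a : ℚ)) ∧
    (1 ≤ a →
      ∃ α : NablaOrbit a → ℚ,
        (∀ u : DeltaOrbit a, R3' a α (Sum.inr ()) (Sum.inl u) = 0) ∧
        (∀ α' : NablaOrbit a → ℚ,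
          (∀ u : DeltaOrbit a, R3' a α' (Sum.inr ()) (Sum.inl u) = 0) → α' = α) ∧
        R3' a α (Sum.inr ()) (Sum.inr ()) =
          (-1 : ℚ) ^ a * ((3 * (a : ℚ) + 2) / (a : ℚ)) *
            (((3 * a).choose (a - 1) : ℚ) / ((2 * a).choose a : ℚ)) ∧
        absDet (M3 (a + 1)) =
          |R3' a α (Sum.inr ()) (Sum.inr ())| * absDet (M3 a)) := by
  have hdet : ∀ b, absDet (M3 b) = (N3 b : ℚ) := fun b => by
    rw [absDet_M3_eq, det_rhombusMatrix_eq_N3, Nat.abs_cast]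
  refine ⟨N3_eq_div a, ⟨⟨(nablaEquiv a).symm.trans (deltaEquiv a)⟩, hdet a⟩, fun ha => ?_⟩
  have hpos := det_rhombusMatrix_pos a
  have hunit : IsUnit (rhombusMatrix a).det := hpos.ne'.isUnit
  obtain ⟨α, hα⟩ : ∃ α : NablaOrbit a → ℚ,
      coefficientRow α = -((-1 : ℚ) ^ a • sideRow a) * (rhombusMatrix a)⁻¹ := by
    refine ⟨fun t => (-((-1 : ℚ) ^ a • sideRow a) * (rhombusMatrix a)⁻¹) ()
      ((nablaEquiv a).symm t), ?_⟩
    ext i c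
    rw [coefficientRow, Matrix.of_apply, Equiv.symm_apply_apply]
  have hα0 : ∀ u, R3' a α (Sum.inr ()) (Sum.inl u) = 0 := by
    rw [R3'_last_row_eq_zero_iff, hα, Matrix.nonsing_inv_mul_cancel_right _ _ hunit]
  have hlast : R3' a α (Sum.inr ()) (Sum.inr ()) =
      (-1 : ℚ) ^ a * ((3 * (a : ℚ) + 2) / (a : ℚ)) *
        (((3 * a).choose (a - 1) : ℚ) / ((2 * a).choose a : ℚ)) := by
    -- The entry is not computed from `α`: two expressions for the determinant of side `a + 1` are
    -- compared, and the nonzero determinant of side `a` is cancelled.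
    have h := det_rhombusMatrix_succ_eq_mul ha hα0
    rw [det_rhombusMatrix_eq_N3, N3_succ_eq_mul ha, ← det_rhombusMatrix_eq_N3 a, mul_comm] at h
    have h' := mul_left_cancel₀ hpos.ne' h
    rw [mul_assoc, h', ← mul_assoc, neg_one_pow_mul_self, one_mul]
  refine ⟨α, hα0, fun α' hα' => ?_, hlast, ?_⟩
  · rw [R3'_last_row_eq_zero_iff] at hα'
    have h : coefficientRow α' = coefficientRow α := by
      rw [hα, ← hα', Matrix.mul_nonsing_inv_cancel_right _ _ hunit]
    ext t
    have := congrFun (congrFun h ()) ((nablaEquiv a).symm t)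
    simpa only [coefficientRow, Matrix.of_apply, Equiv.apply_symm_apply] using this
  · rw [hdet, hdet, hlast, mul_assoc, abs_mul, abs_pow, abs_neg, abs_one, one_pow, one_mul,
      abs_of_nonneg (by positivity), N3_succ_eq_mul ha]
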